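/- Let $\mathbb F$ be a field, let $n\ge 0$ be an integer, and let $P=2^{[n]}$ be the lattice of subsets of $[n]=\{1,\dots,n\}$, ordered by inclusion. Let $E_P=\{(q,p)\in P\times P : q \text{ covers } p\}$ be the set of edges of the Hasse diagram of $P$; the edge $(q,p)$ has tail $q$ and head $p$. A path is a nonempty tuple $\pi=(e_1,\dots,e_m)$ of edges such that the head of $e_i$ is the tail of $e_{i+1}$ for $1\le i<m$; its tail is the tail of $e_1$ and its head is the head of $e_m$. Write $\pi_1\approx\pi_2$ if $\pi_1,\pi_2$ have the same tail and the same head. In the polynomial ring $\mathbb F\langle E_P\rangle[t]$ over the free algebra $\mathbb F\langle E_P\rangle$, with $t$ a central variable, put $$(t-e_1)(t-e_2)\cdots(t-e_m)=\sum_{i\ge 0} e(\pi,i)\,t^i .$$ The splitting algebra of $P$ is $A(P)=\mathbb F\langle E_P\rangle/R$, where $R$ is the two-sided ideal generated by all $e(\pi_1,i)-e(\pi_2,i)$ with $\pi_1\approx\pi_2$ and $i\ge 0$. The ideal $R$ is homogeneous, so $A(P)=\bigoplus_{i\ge0}A(P)_i$ inherits the grading of $\mathbb F\langle E_P\rangle$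 in which every edge has degree $1$. Then the Hilbert series $H(A(P),z)=\sum_{i\ge 0}\dim_{\mathbb F}(A(P)_i)\,z^i$ of the splitting algebra of $P=2^{[n]}$ satisfies, as a formal power series, $$H\left(A\left(2^{[n]}\right),z\right)=\frac{1-z}{1-z(2-z)^n}.$$ -/

import Mathlib

/-- An edge of the Hasse diagram of `P`: a pair `(q, p)` with `p` covered by `q`.
The edge points downwards, from its tail `q` to its head `p`. -/
def HasseEdge (P : Type*) [PartialOrder P] : Type _ :=
  {e : P × P // e.2 ⋖ e.1}

namespace HasseEdge

/-- The tail `q` of the edge `(q, p)`. -/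
def tail {P : Type*} [PartialOrder P] (e : HasseEdge P) : P := e.1.1

/-- The head `p` of the edge `(q, p)`. -/
def head {P : Type*} [PartialOrder P] (e : HasseEdge P) : P := e.1.2

end HasseEdge

/-- A path in the Hasse diagram: a nonempty tuple of edges `(e₁, …, eₙ)` such that the head of
`eᵢ` is the tail of `eᵢ₊₁`. -/
structure HassePath (P : Type*) [PartialOrder P] where
  edges : List (HasseEdge P)
  ne_nil : edges ≠ []
  chain : edges.IsChain (fun e f => e.head = f.tail)

namespace HassePath

/-- The tail of a path is the tail of its first edge. -/
def tail {P : Type*} [PartialOrder P] (π : HassePath P) : P := (π.edges.head π.ne_nil).tail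

/-- The head of a path is the head of its last edge. -/
def head {P : Type*} [PartialOrder P] (π : HassePath P) : P := (π.edges.getLast π.ne_nil).head

/-- Two paths are equivalent if they have the same tail and the same head. -/
def Equivalent {P : Type*} [PartialOrder P] (π₁ π₂ : HassePath P) : Prop :=
  π₁.tail = π₂.tail ∧ π₁.head = π₂.head

end HassePath

noncomputable section

namespace SplittingAlgebra

/-- The polynomial `(t - e₁)(t - e₂)⋯(t - eₙ)` in a central variable `t`, with coefficients in
the free algebra on the edges. -/
def listPoly (F : Type*) [Field F] {P : Type*} [PartialOrder P] (l : List (HasseEdge P)) :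
    Polynomial (FreeAlgebra F (HasseEdge P)) :=
  (l.map fun e => Polynomial.X - Polynomial.C (FreeAlgebra.ι F e)).prod

/-- The coefficient `e(π, i)` of `tⁱ` in `(t - e₁)(t - e₂)⋯(t - eₙ)`, for `π = (e₁, …, eₙ)`. -/
def pathCoeff (F : Type*) [Field F] {P : Type*} [PartialOrder P] (π : HassePath P) (i : ℕ) :
    FreeAlgebra F (HasseEdge P) :=
  (listPoly F π.edges).coeff i

/-- The defining relations `e(π₁, i) = e(π₂, i)` for equivalent paths `π₁`, `π₂`. -/
inductive Rel (F : Type*) [Field F] (P : Type*) [PartialOrder P] :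
    FreeAlgebra F (HasseEdge P) → FreeAlgebra F (HasseEdge P) → Prop
  | of_equivalent (π₁ π₂ : HassePath P) (h : π₁.Equivalent π₂) (i : ℕ) :
      Rel F P (pathCoeff F π₁ i) (pathCoeff F π₂ i)

end SplittingAlgebra

/-- The splitting algebra `A(P)`: the quotient of the free algebra on the edges of the Hasse
diagram by the two-sided ideal generated by the elements `e(π₁, i) - e(π₂, i)` for equivalent
paths `π₁`, `π₂`. -/
abbrev SplittingAlgebra (F : Type*) [Field F] (P : Type*) [PartialOrder P] : Type _ :=
  RingQuot (SplittingAlgebra.Rel F P)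

namespace SplittingAlgebra

/-- The degree `i` part of the free algebra on the edges: the span of the words of length `i`. -/
def freePart (F : Type*) [Field F] (P : Type*) [PartialOrder P] (i : ℕ) :
    Submodule F (FreeAlgebra F (HasseEdge P)) :=
  Submodule.span F (Set.range (FreeAlgebra.ι F)) ^ i

/-- The degree `i` part of `A(P)`: the image of the degree `i` part of the free algebra. -/
def part (F : Type*) [Field F] (P : Type*) [PartialOrder P] (i : ℕ) :
    Submodule F (SplittingAlgebra F P) :=
  (freePart F P i).map (RingQuot.mkAlgHom F (Rel F P)).toLinearMap

instance part_gradedMonoid (F : Type*) [Field F] (P : Type*) [PartialOrder P] :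
    SetLike.GradedMonoid (part F P) where
  one_mem := ⟨1, by simp [freePart], by simp⟩
  mul_mem := by
    rintro i j _ _ ⟨x, hx, rfl⟩ ⟨y, hy, rfl⟩
    refine ⟨x * y, ?_, by simp⟩
    simp only [freePart, SetLike.mem_coe] at hx hy ⊢
    rw [pow_add]
    exact Submodule.mul_mem_mul hx hy

instance part_finite (F : Type*) [Field F] (P : Type*) [PartialOrder P] [Finite P] (i : ℕ) :
    Module.Finite F (part F P i) := by
  have : Finite (HasseEdge P) := inferInstanceAs (Finite {e : P × P // e.2 ⋖ e.1})
  rw [Module.Finite.iff_fg]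
  exact ((Submodule.fg_span (Set.finite_range _)).pow i).map _

theorem listPoly_coeff (F : Type*) [Field F] {P : Type*} [PartialOrder P]
    (l : List (HasseEdge P)) :
    (∀ i d, i + d = l.length → (listPoly F l).coeff i ∈ freePart F P d) ∧
      ∀ i, l.length < i → (listPoly F l).coeff i = 0 := by
  induction l with
  | nil =>
    refine ⟨fun i d h => ?_, fun i h => ?_⟩
    · obtain ⟨rfl, rfl⟩ : i = 0 ∧ d = 0 := by simpa using h
      simp [listPoly, freePart]
    · have : i ≠ 0 := by simp at h; omega
      simp [listPoly, Polynomial.coeff_one, this]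
  | cons e l ih =>
    obtain ⟨ih1, ih2⟩ := ih
    have hp : listPoly F (e :: l) =
        Polynomial.X * listPoly F l - Polynomial.C (FreeAlgebra.ι F e) * listPoly F l := by
      simp [listPoly, sub_mul]
    have he : ∀ d x, x ∈ freePart F P d → FreeAlgebra.ι F e * x ∈ freePart F P (d + 1) := by
      intro d x hx
      unfold freePart at hx ⊢
      rw [pow_succ']
      exact Submodule.mul_mem_mul (Submodule.subset_span ⟨e, rfl⟩) hx
    rw [hp]
    refine ⟨fun i d h => ?_, fun i h => ?_⟩
    · rw [List.length_cons] at h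
      rw [Polynomial.coeff_sub, Polynomial.coeff_C_mul]
      refine Submodule.sub_mem _ ?_ ?_
      · cases i with
        | zero => simp
        | succ j => rw [Polynomial.coeff_X_mul]; exact ih1 j d (by omega)
      · cases d with
        | zero => rw [ih2 i (by omega), mul_zero]; exact Submodule.zero_mem _
        | succ d => exact he _ _ (ih1 i d (by omega))
    · rw [List.length_cons] at h
      rw [Polynomial.coeff_sub, Polynomial.coeff_C_mul, ih2 i (by omega)]
      cases i with
      | zero => omega
      | succ j => rw [Polynomial.coeff_X_mul, ih2 j (by omega)]; simp

theorem grade_path {P : Type*} [PartialOrder P] [GradeMinOrder ℕ P] (l : List (HasseEdge P))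
    (hl : l ≠ []) (hc : l.IsChain (fun e f => e.head = f.tail)) :
    grade ℕ (l.head hl).tail = grade ℕ (l.getLast hl).head + l.length := by
  induction l with
  | nil => exact absurd rfl hl
  | cons e l ih =>
    have he : grade ℕ e.tail = grade ℕ e.head + 1 :=
      (Nat.covBy_iff_add_one_eq.1 (e.2.grade ℕ)).symm
    cases l with
    | nil => simpa using he
    | cons f l =>
      rw [List.isChain_cons_cons] at hc
      have := ih (by simp) hc.2
      simp only [List.head_cons, List.length_cons, List.getLast_cons_cons] at this ⊢
      rw [he, hc.1, this]
      omega

/-- The map of the free algebra into the external direct sum of the parts of `A(P)`. -/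
def toSumAux (F : Type*) [Field F] (P : Type*) [PartialOrder P] :
    FreeAlgebra F (HasseEdge P) →ₐ[F] DirectSum ℕ fun i => part F P i :=
  FreeAlgebra.lift F fun e => DirectSum.lof F ℕ (fun i => part F P i) 1
    ⟨RingQuot.mkAlgHom F (Rel F P) (FreeAlgebra.ι F e),
      ⟨FreeAlgebra.ι F e, by
        rw [freePart, pow_one]; exact Submodule.subset_span ⟨e, rfl⟩, rfl⟩⟩

theorem coe_toSumAux (F : Type*) [Field F] (P : Type*) [PartialOrder P]
    (x : FreeAlgebra F (HasseEdge P)) :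
    DirectSum.coeAlgHom (part F P) (toSumAux F P x) = RingQuot.mkAlgHom F (Rel F P) x := by
  have : (DirectSum.coeAlgHom (part F P)).comp (toSumAux F P) =
      RingQuot.mkAlgHom F (Rel F P) := by
    apply FreeAlgebra.hom_ext
    funext e
    simp only [toSumAux, Function.comp_apply, AlgHom.comp_apply, FreeAlgebra.lift_ι_apply]
    exact DirectSum.coeAlgHom_of _ _ _
  exact DFunLike.congr_fun this x

theorem toSumAux_mem (F : Type*) [Field F] (P : Type*) [PartialOrder P] (d : ℕ)
    (x : FreeAlgebra F (HasseEdge P)) (hx : x ∈ freePart F P d) :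
    ∃ y : part F P d, (y : SplittingAlgebra F P) = RingQuot.mkAlgHom F (Rel F P) x ∧
      toSumAux F P x = DirectSum.of (fun i => part F P i) d y := by
  have key : ∃ y : part F P d, toSumAux F P x = DirectSum.of (fun i => part F P i) d y := by
    induction d generalizing x with
    | zero =>
      rw [freePart, pow_zero, Submodule.mem_one] at hx
      obtain ⟨r, rfl⟩ := hx
      refine ⟨⟨algebraMap F _ r, ⟨algebraMap F _ r, ?_, by simp⟩⟩, ?_⟩
      · rw [freePart, pow_zero]; exact Submodule.mem_one.2 ⟨r, rfl⟩
      · rw [AlgHom.commutes]; rfl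
    | succ d ih =>
      rw [freePart, pow_succ] at hx
      refine Submodule.mul_induction_on hx ?_ ?_
      · intro a ha b hb
        obtain ⟨y, hy⟩ := ih a ha
        have hb' : ∃ z : part F P 1,
            toSumAux F P b = DirectSum.of (fun i => part F P i) 1 z := by
          refine Submodule.span_induction ?_ ?_ ?_ ?_ hb
          · rintro _ ⟨e, rfl⟩
            exact ⟨_, FreeAlgebra.lift_ι_apply _ _⟩
          · exact ⟨0, by simp⟩
          · rintro u v _ _ ⟨y, hy⟩ ⟨z, hz⟩
            exact ⟨y + z, by rw [map_add, map_add, hy, hz]⟩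
          · rintro r u _ ⟨y, hy⟩
            refine ⟨r • y, ?_⟩
            rw [map_smul, hy]
            exact ((DirectSum.lof F ℕ (fun i => part F P i) 1).map_smul r y).symm
        obtain ⟨z, hz⟩ := hb'
        refine ⟨⟨y * z, SetLike.mul_mem_graded y.2 z.2⟩, ?_⟩
        rw [map_mul, hy, hz, DirectSum.of_mul_of]
        rfl
      · rintro u v ⟨y, hy⟩ ⟨z, hz⟩
        exact ⟨y + z, by rw [map_add, map_add, hy, hz]⟩
  obtain ⟨y, hy⟩ := key
  refine ⟨y, ?_, hy⟩
  rw [← coe_toSumAux, hy]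
  exact (DirectSum.coeAlgHom_of _ _ _).symm

theorem toSumAux_rel (F : Type*) [Field F] (P : Type*) [PartialOrder P] [GradeMinOrder ℕ P]
    ⦃x y : FreeAlgebra F (HasseEdge P)⦄ (h : Rel F P x y) : toSumAux F P x = toSumAux F P y := by
  have hmk := RingQuot.mkAlgHom_rel F h
  obtain ⟨π₁, π₂, ⟨ht, hh⟩, i⟩ := h
  have hlen : π₁.edges.length = π₂.edges.length := by
    have h1 := grade_path π₁.edges π₁.ne_nil π₁.chain
    have h2 := grade_path π₂.edges π₂.ne_nil π₂.chain
    simp only [HassePath.tail, HassePath.head] at ht hh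
    rw [ht, hh] at h1
    omega
  rcases le_or_gt i π₁.edges.length with hi | hi
  · obtain ⟨d, hd⟩ := Nat.exists_eq_add_of_le hi
    obtain ⟨y₁, hy₁, e₁⟩ := toSumAux_mem F P d (pathCoeff F π₁ i)
      ((listPoly_coeff F π₁.edges).1 i d hd.symm)
    obtain ⟨y₂, hy₂, e₂⟩ := toSumAux_mem F P d (pathCoeff F π₂ i)
      ((listPoly_coeff F π₂.edges).1 i d (by omega))
    rw [e₁, e₂, Subtype.ext (hy₁.trans (hmk.trans hy₂.symm))]
  · simp only [pathCoeff]
    rw [(listPoly_coeff F π₁.edges).2 i hi, (listPoly_coeff F π₂.edges).2 i (by omega)]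

/-- For a ranked poset the relations are homogeneous, so that `A(P)` inherits the grading of the
free algebra. -/
instance gradedAlgebra (F : Type*) [Field F] (P : Type*) [PartialOrder P] [GradeMinOrder ℕ P] :
    GradedAlgebra (part F P) :=
  GradedAlgebra.ofAlgHom (part F P)
    (RingQuot.liftAlgHom F ⟨toSumAux F P, toSumAux_rel F P⟩)
    (by
      apply RingQuot.ringQuot_ext'
      refine AlgHom.ext fun x => ?_
      simpa using coe_toSumAux F P x)
    (by
      rintro i ⟨_, x, hx, rfl⟩
      obtain ⟨y, hy, e⟩ := toSumAux_mem F P i x hx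
      simp only [AlgHom.toLinearMap_apply, RingQuot.liftAlgHom_mkAlgHom_apply]
      rw [e]
      congr 1
      exact Subtype.ext hy)

end SplittingAlgebra

/-- The Hilbert series `∑ dim(Aᵢ) zⁱ` of a graded algebra `A = ⨁ Aᵢ` with finite-dimensional
homogeneous parts. -/
def hilbertSeries (F : Type*) [Field F] {A : Type*} [Ring A] [Algebra F A]
    (𝒜 : ℕ → Submodule F A) [GradedAlgebra 𝒜] [∀ i, Module.Finite F (𝒜 i)] : PowerSeries ℚ :=
  PowerSeries.mk fun i => (Module.finrank F (𝒜 i) : ℚ)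

end

/-! In `A(P)` the product of the factors `t - e` along a path from `v` down to the bottom does not
depend on the path. It is a monic polynomial `p_v` of degree `grade v`, and its lower coefficients,
the letters `⟨v, j⟩`, generate the algebra. If `u < v` then `p_v = Q * p_u`. So when `grade u = j`,
the product of `⟨v, j⟩` and `⟨u, i⟩` equals `⟨v, i⟩` up to terms of smaller weight. Words without
such adjacent pairs, the normal words, therefore span (`letterValue_mul_sub_mem`,
`part_eq_span_normal`).

Independence comes from a representation on the space `M` with all words as basis. A polynomial over
`End M` acts on sequences in `M`, with `t` acting as the shift, so a monic polynomial is a linear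
recurrence. Inclusion between solution spaces of consecutive orders forces a right factorization by
some `t - a` (`exists_eq_X_sub_C_mul`). Hence recurrences `p_v` whose solution spaces increase with
`v` define an action of `A(P)`. They are built by induction on the grade, as freely as the
inclusions allow (`exists_isFreeExtension`), so that a normal word applied to the empty word returns
the corresponding basis vector (`action_wordValue`).

Thus `dim A(P)_d` is the number of normal words of degree `d` (`finrank_part`). For the Boolean
lattice, removing the first letter gives a linear system for the generating functions, which the
binomial theorem solves (`normalSeries_finset_mul`). -/

noncomputable section

namespace SplittingAlgebra

/-! ### Normal words and their weights -/

section Words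

open PowerSeries

variable {P : Type*} [PartialOrder P] [GradeMinOrder ℕ P]

/-- The letter `⟨v, j⟩` stands for the coefficient of `tʲ` in the monic polynomial of degree
`grade v` attached to `v`. -/
abbrev Letter (P : Type*) [PartialOrder P] [GradeMinOrder ℕ P] : Type _ :=
  Σ v : P, Fin (grade ℕ v)

namespace Letter

/-- The degree of the coefficient that a letter stands for. -/
def degree (x : Letter P) : ℕ := grade ℕ x.1 - x.2

theorem degree_pos (x : Letter P) : 0 < x.degree := Nat.sub_pos_of_lt x.2.2

theorem degree_add (x : Letter P) : x.degree + x.2 = grade ℕ x.1 :=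
  Nat.sub_add_cancel x.2.2.le

/-- The pairs of consecutive letters that are excluded from normal words. -/
def Covers (x y : Letter P) : Prop := y.1 < x.1 ∧ grade ℕ y.1 = x.2

end Letter

/-- The degree of a word is the sum of the degrees of its letters. -/
def wordDegree (W : List (Letter P)) : ℕ := (W.map Letter.degree).sum

@[simp] theorem wordDegree_nil : wordDegree ([] : List (Letter P)) = 0 := rfl

@[simp] theorem wordDegree_cons (x : Letter P) (W : List (Letter P)) :
    wordDegree (x :: W) = x.degree + wordDegree W := by simp [wordDegree]

@[simp] theorem wordDegree_append (V W : List (Letter P)) :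
    wordDegree (V ++ W) = wordDegree V + wordDegree W := by simp [wordDegree]

theorem length_le_wordDegree (W : List (Letter P)) : W.length ≤ wordDegree W := by
  induction W with
  | nil => simp
  | cons x W ih =>
    have := x.degree_pos
    simp only [List.length_cons, wordDegree_cons]
    omega

/-- A word is normal if no letter covers its successor. -/
def IsNormal (W : List (Letter P)) : Prop := W.IsChain fun x y => ¬ x.Covers y

theorem sum_Ioc_add (a b c : ℕ) :
    ∑ r ∈ Finset.Ioc (a + c) (a + b + c), r = ∑ r ∈ Finset.Ioc a (a + b), r + b * c := by
  induction b with
  | zero => simp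
  | succ b ih =>
    have e : a + (b + 1) + c = a + b + c + 1 := by ring
    rw [e, ← Finset.sum_Ioc_consecutive _ (by omega : a + c ≤ a + b + c) (Nat.le_succ _), ih,
      ← Finset.sum_Ioc_consecutive _ (by omega : a ≤ a + b) (by omega : a + b ≤ a + (b + 1)),
      ← add_assoc a b 1, Nat.Ioc_succ_singleton, Nat.Ioc_succ_singleton]
    simp only [Finset.sum_singleton]
    ring

/-- Sliding an interval of fixed positive length upwards increases its sum. This makes the error
terms of the rewriting strictly lighter. -/
theorem sum_Ioc_lt {a b c : ℕ} (hb : 0 < b) (h : a < c) :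
    ∑ r ∈ Finset.Ioc a (a + b), r < ∑ r ∈ Finset.Ioc c (c + b), r := by
  obtain ⟨d, rfl⟩ := Nat.exists_eq_add_of_lt h
  have := sum_Ioc_add a b (d + 1)
  rw [show a + d + 1 = a + (d + 1) by ring, show a + (d + 1) + b = a + b + (d + 1) by ring, this]
  have : 0 < b * (d + 1) := by positivity
  omega

/-- The weight of a letter. -/
def Letter.weight (x : Letter P) : ℕ := ∑ r ∈ Finset.Ioc (x.2 : ℕ) (grade ℕ x.1), r

/-- The weight of a word is the sum of the weights of its letters. -/
def wordWeight (W : List (Letter P)) : ℕ := (W.map Letter.weight).sum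

@[simp] theorem wordWeight_cons (x : Letter P) (W : List (Letter P)) :
    wordWeight (x :: W) = x.weight + wordWeight W := by simp [wordWeight]

@[simp] theorem wordWeight_append (V W : List (Letter P)) :
    wordWeight (V ++ W) = wordWeight V + wordWeight W := by simp [wordWeight]

theorem Letter.weight_pos (x : Letter P) : 0 < x.weight :=
  Finset.sum_pos' (fun _ _ => Nat.zero_le _)
    ⟨grade ℕ x.1, Finset.mem_Ioc.2 ⟨x.2.2, le_rfl⟩, (Nat.zero_le _).trans_lt x.2.2⟩

theorem exists_covers_of_not_isNormal {W : List (Letter P)} (h : ¬ IsNormal W) :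
    ∃ U x y V, W = U ++ x :: y :: V ∧ Letter.Covers x y := by
  induction W with
  | nil => exact absurd List.isChain_nil h
  | cons x W ih =>
    by_cases hW : IsNormal W
    · cases W with
      | nil => exact absurd (List.isChain_singleton x) h
      | cons y V =>
        refine ⟨[], x, y, V, rfl, ?_⟩
        by_contra hxy
        exact h (List.isChain_cons_cons.2 ⟨hxy, hW⟩)
    · obtain ⟨U, y, z, V, rfl, hyz⟩ := ih hW
      exact ⟨x :: U, y, z, V, rfl, hyz⟩

theorem finite_normal [Finite P] (N : ℕ) :
    {W : List (Letter P) | IsNormal W ∧ wordDegree W = N}.Finite :=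
  (List.finite_length_le (Letter P) N).subset fun W hW =>
    (length_le_wordDegree W).trans_eq hW.2

/-! ### Counting normal words by first letter -/

/-- The normal words of degree `N`. -/
def normalWords (P : Type*) [PartialOrder P] [GradeMinOrder ℕ P] [Finite P] (N : ℕ) :
    Finset (List (Letter P)) :=
  (finite_normal N).toFinset

@[simp] theorem mem_normalWords [Finite P] {N : ℕ} {W : List (Letter P)} :
    W ∈ normalWords P N ↔ IsNormal W ∧ wordDegree W = N := by
  simp [normalWords]

open Classical in
/-- The normal words of degree `N` with first letter `x`. -/
def normalWordsFrom [Finite P] (x : Letter P) (N : ℕ) : Finset (List (Letter P)) :=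
  (normalWords P N).filter fun W => W.head? = some x

open Classical in
theorem card_normalWords [Fintype P] (N : ℕ) :
    (normalWords P N).card =
      (if N = 0 then 1 else 0) + ∑ x : Letter P, (normalWordsFrom x N).card := by
  have h : (normalWords P N).card =
      ∑ o : Option (Letter P), ((normalWords P N).filter fun W => W.head? = o).card :=
    Finset.card_eq_sum_card_fiberwise fun _ _ => Finset.mem_coe.2 (Finset.mem_univ _)
  rw [h, Fintype.sum_option]
  congr 1
  have : ((normalWords P N).filter fun W => W.head? = none) = if N = 0 then {[]} else ∅ := by
    ext W
    simp only [Finset.mem_filter, mem_normalWords, List.head?_eq_none_iff]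
    constructor
    · rintro ⟨⟨-, h⟩, rfl⟩
      simp at h
      simp [← h]
    · intro h
      split_ifs at h with hN
      · simp at h
        subst h hN
        simp [IsNormal]
      · simp at h
  rw [this]
  split_ifs <;> simp

-- Deleting the first letter `x` is a bijection onto the normal words of degree `N` whose first
-- letter, if any, is not covered by `x`; the remaining ones are sorted by their first letter.
open Classical in
theorem card_normalWordsFrom_add [Fintype P] (x : Letter P) (N : ℕ) :
    (normalWordsFrom x (N + x.degree)).card +
      ∑ y ∈ Finset.univ.filter x.Covers, (normalWordsFrom y N).card =
        (normalWords P N).card := by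
  have h1 : normalWordsFrom x (N + x.degree) =
      ((normalWords P N).filter fun W => ∀ y ∈ W.head?, ¬ x.Covers y).image (List.cons x) := by
    ext W
    simp only [normalWordsFrom, Finset.mem_filter, mem_normalWords, Finset.mem_image]
    constructor
    · rintro ⟨⟨hW, hd⟩, hx⟩
      cases W with
      | nil => simp at hx
      | cons y W =>
        obtain rfl : y = x := by simpa using hx
        rw [IsNormal, List.isChain_cons] at hW
        rw [wordDegree_cons] at hd
        exact ⟨W, ⟨⟨hW.2, by omega⟩, hW.1⟩, rfl⟩
    · rintro ⟨W, ⟨⟨hW, hd⟩, hx⟩, rfl⟩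
      refine ⟨⟨List.isChain_cons.2 ⟨hx, hW⟩, ?_⟩, rfl⟩
      rw [wordDegree_cons, hd, add_comm]
  have h2 : ∑ y ∈ Finset.univ.filter x.Covers, (normalWordsFrom y N).card =
      ((normalWords P N).filter fun W => ¬ ∀ y ∈ W.head?, ¬ x.Covers y).card := by
    rw [← Finset.card_biUnion]
    · congr 1
      ext W
      simp only [normalWordsFrom, Finset.mem_biUnion, Finset.mem_filter, Finset.mem_univ,
        true_and]
      push Not
      constructor
      · rintro ⟨y, hy, hW, h⟩
        exact ⟨hW, y, h, hy⟩
      · rintro ⟨hW, y, h, hy⟩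
        exact ⟨y, hy, hW, h⟩
    · intro y _ z _ hyz
      rw [Function.onFun, Finset.disjoint_left]
      intro W hy hz
      simp only [normalWordsFrom, Finset.mem_filter] at hy hz
      exact hyz (Option.some.inj (hy.2.symm.trans hz.2))
  rw [h1, h2, Finset.card_image_of_injective _ List.cons_injective]
  exact Finset.card_filter_add_card_filter_not _

theorem normalWordsFrom_of_lt [Finite P] (x : Letter P) {N : ℕ} (h : N < x.degree) :
    normalWordsFrom x N = ∅ := by
  classical
  rw [Finset.eq_empty_iff_forall_notMem]
  intro W hW
  simp only [normalWordsFrom, Finset.mem_filter, mem_normalWords] at hW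
  cases W with
  | nil => simp at hW
  | cons y W =>
    obtain rfl : y = x := by simpa using hW.2
    have := hW.1.2
    rw [wordDegree_cons] at this
    omega

/-- The generating function of the normal words by degree. -/
def normalSeries (P : Type*) [PartialOrder P] [GradeMinOrder ℕ P] [Finite P] : PowerSeries ℚ :=
  mk fun N => ((normalWords P N).card : ℚ)

/-- The generating function of the normal words whose first letter is `x`. -/
def normalSeriesFrom [Finite P] (x : Letter P) : PowerSeries ℚ :=
  mk fun N => ((normalWordsFrom x N).card : ℚ)

theorem normalSeries_eq [Fintype P] :
    normalSeries P = 1 + ∑ x : Letter P, normalSeriesFrom x := by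
  ext N
  simp only [normalSeries, normalSeriesFrom, coeff_mk, map_add, map_sum, coeff_one]
  rw [card_normalWords]
  push_cast
  rfl

open Classical in
theorem normalSeriesFrom_add [Fintype P] (x : Letter P) :
    normalSeriesFrom x + X ^ x.degree * ∑ y ∈ Finset.univ.filter x.Covers, normalSeriesFrom y =
      X ^ x.degree * normalSeries P := by
  ext N
  rw [map_add, coeff_X_pow_mul', coeff_X_pow_mul']
  simp only [normalSeries, normalSeriesFrom, coeff_mk, map_sum]
  split_ifs with h
  · obtain ⟨M, rfl⟩ := Nat.exists_eq_add_of_le' h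
    rw [Nat.add_sub_cancel, ← card_normalWordsFrom_add x M]
    push_cast
    rfl
  · rw [normalWordsFrom_of_lt x (by omega)]
    simp

/-- The generating function of the normal words whose first letter belongs to `v`. -/
def vertexSeries [Finite P] (v : P) : PowerSeries ℚ :=
  ∑ j : Fin (grade ℕ v), normalSeriesFrom ⟨v, j⟩

-- For `u < v`, exactly one letter of `v` covers the letters of `u`, namely the one with `j = grade
-- u`. Summing over `j` therefore leaves a single power of `X` for each `u`.
open Classical in
theorem vertexSeries_add [Fintype P] [DecidableLT P] (v : P) :
    vertexSeries v + ∑ u ∈ Finset.univ.filter (· < v),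
        X ^ (grade ℕ v - grade ℕ u) * vertexSeries u =
      (∑ k ∈ Finset.range (grade ℕ v), X ^ (k + 1)) * normalSeries P := by
  have h : ∀ j : Fin (grade ℕ v), normalSeriesFrom ⟨v, j⟩ +
      ∑ u ∈ Finset.univ.filter (· < v),
        (if grade ℕ u = j then X ^ (grade ℕ v - j) * vertexSeries u else 0) =
      X ^ (grade ℕ v - j) * normalSeries P := by
    intro j
    have hj := normalSeriesFrom_add (⟨v, j⟩ : Letter P)
    simp only [Letter.degree] at hj
    rw [← hj, add_right_inj, Finset.mul_sum, Finset.sum_filter,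
      Finset.sum_filter, Fintype.sum_sigma]
    refine Finset.sum_congr rfl fun u _ => ?_
    simp only [Letter.Covers, vertexSeries]
    by_cases h1 : u < v <;> by_cases h2 : grade ℕ u = j <;> simp [h1, h2, Finset.mul_sum]
  have h' := Finset.sum_congr (rfl : (Finset.univ : Finset (Fin (grade ℕ v))) = _) fun j _ => h j
  rw [Finset.sum_add_distrib, Finset.sum_comm, ← Finset.sum_mul] at h'
  have e1 : ∑ j : Fin (grade ℕ v), (X : PowerSeries ℚ) ^ (grade ℕ v - j) =
      ∑ k ∈ Finset.range (grade ℕ v), X ^ (k + 1) := by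
    rw [Fin.sum_univ_eq_sum_range (fun j => (X : PowerSeries ℚ) ^ (grade ℕ v - j)),
      ← Finset.sum_range_reflect]
    refine Finset.sum_congr rfl fun k hk => ?_
    rw [Finset.mem_range] at hk
    congr 1
    omega
  rw [← e1, ← h', vertexSeries]
  congr 1
  refine Finset.sum_congr rfl fun u hu => ?_
  have hlt : grade ℕ u < grade ℕ v := grade_strictMono (Finset.mem_filter.1 hu).2
  rw [Finset.sum_eq_single ⟨grade ℕ u, hlt⟩]
  · simp
  · intro j _ hj
    rw [if_neg]
    rintro h
    exact hj (Fin.ext h.symm)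
  · simp

theorem normalSeries_eq_sum_vertexSeries [Fintype P] :
    normalSeries P = 1 + ∑ v : P, vertexSeries v := by
  rw [normalSeries_eq, Fintype.sum_sigma]
  rfl

/-- The recurrence over proper subsets is solved by strong induction. The correction at `∅` reflects
that the empty set has no letters. -/
theorem one_sub_mul_vertexSeries (n : ℕ) (v : Finset (Fin n)) :
    (1 - X) * vertexSeries v =
      X * normalSeries (Finset (Fin n)) * ((1 - X) ^ v.card - if v = ∅ then 1 else 0) := by
  induction v using Finset.strongInduction with
  | _ v ih =>
  have h := congrArg (fun f => (1 - X) * f) (vertexSeries_add v)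
  simp only [mul_add, Finset.mul_sum, Finset.grade_eq] at h
  have hgeom : (1 - X : PowerSeries ℚ) *
      ∑ k ∈ Finset.range v.card, X ^ (k + 1) = X * (1 - X ^ v.card) := by
    have := mul_neg_geom_sum (X : PowerSeries ℚ) v.card
    rw [← this, Finset.mul_sum, Finset.mul_sum, Finset.mul_sum]
    exact Finset.sum_congr rfl fun k _ => by ring
  rw [← mul_assoc, hgeom] at h
  have hs : ∑ u ∈ Finset.univ.filter (· < v),
      (1 - X) * (X ^ (v.card - u.card) * vertexSeries u) =
      X * normalSeries (Finset (Fin n)) * ∑ u ∈ Finset.univ.filter (· < v),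
        X ^ (v.card - u.card) * ((1 - X) ^ u.card - if u = ∅ then 1 else 0) := by
    rw [Finset.mul_sum]
    refine Finset.sum_congr rfl fun u hu => ?_
    rw [mul_left_comm, ih u (Finset.mem_filter.1 hu).2]
    ring
  have hb : ∑ u ∈ Finset.univ.filter (· < v),
        (X : PowerSeries ℚ) ^ (v.card - u.card) * ((1 - X) ^ u.card - if u = ∅ then 1 else 0) =
      1 - (1 - X) ^ v.card - (X ^ v.card - if v = ∅ then 1 else 0) := by
    -- The binomial sum over subsets of `v` collapses to `1` because `(1 - X) + X = 1`.
    have h1 := Finset.sum_pow_mul_eq_add_pow (1 - X : PowerSeries ℚ) X v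
    rw [sub_add_cancel, one_pow] at h1
    have h2 : v.powerset = insert v (Finset.univ.filter (· < v)) := by
      ext u
      simp [le_iff_eq_or_lt]
    have h3 : ∑ u ∈ v.powerset, (X : PowerSeries ℚ) ^ (v.card - u.card) *
        ((1 - X) ^ u.card - if u = ∅ then 1 else 0) = 1 - X ^ v.card := by
      simp only [mul_sub, Finset.sum_sub_distrib]
      congr 1
      · refine Eq.trans ?_ h1
        exact Finset.sum_congr rfl fun u _ => mul_comm _ _
      · rw [Finset.sum_eq_single ∅] <;> simp +contextual
    rw [h2, Finset.sum_insert (by simp)] at h3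
    simp only [Nat.sub_self, pow_zero, one_mul] at h3
    rw [← sub_eq_iff_eq_add'.2 h3.symm]
    ring
  rw [hs, hb] at h
  linear_combination h

theorem normalSeries_finset_mul (n : ℕ) :
    normalSeries (Finset (Fin n)) * (1 - X * (2 - X) ^ n) = 1 - X := by
  have h := congrArg (fun f => (1 - X) * f) (normalSeries_eq_sum_vertexSeries (P := Finset (Fin n)))
  simp only [mul_add, Finset.mul_sum, one_sub_mul_vertexSeries] at h
  rw [← Finset.mul_sum, Finset.sum_sub_distrib] at h
  have h1 : ∑ v : Finset (Fin n), (1 - X : PowerSeries ℚ) ^ v.card = (2 - X) ^ n := by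
    have := Fintype.sum_pow_mul_eq_add_pow (Fin n) (1 - X : PowerSeries ℚ) 1
    simp only [one_pow, mul_one, Fintype.card_fin] at this
    rw [this]
    congr 1
    ring
  rw [h1] at h
  simp at h
  linear_combination h

end Words

/-! ### Path polynomials and spanning by normal words -/

section Spanning

open Polynomial

/-- The paths from a vertex to the bottom element, the empty path included. -/
inductive PathToBot {P : Type*} [PartialOrder P] [OrderBot P] : P → List (HasseEdge P) → Prop
  | nil : PathToBot ⊥ []
  | cons (e : HasseEdge P) {l : List (HasseEdge P)} (h : PathToBot e.head l) :
      PathToBot e.tail (e :: l)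

theorem coeff_X_sub_C_mul {R : Type*} [Ring R] (a : R) (p : R[X]) (n : ℕ) :
    ((X - C a) * p).coeff n = (X * p).coeff n - a * p.coeff n := by
  rw [sub_mul, coeff_sub, coeff_C_mul]

theorem mul_mul_mul_eq_add {R : Type*} [Ring R] (u x y z v : R) :
    u * (x * (y * v)) = u * (x * y - z) * v + u * (z * v) := by
  noncomm_ring

section ListPoly

variable (F : Type*) [Field F] {P : Type*} [PartialOrder P]

@[simp] theorem listPoly_nil : listPoly F ([] : List (HasseEdge P)) = 1 := rfl

theorem listPoly_cons (e : HasseEdge P) (l : List (HasseEdge P)) :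
    listPoly F (e :: l) = (X - C (FreeAlgebra.ι F e)) * listPoly F l := by
  simp [listPoly]

theorem listPoly_monic (l : List (HasseEdge P)) :
    (listPoly F l).Monic ∧ (listPoly F l).natDegree = l.length := by
  induction l with
  | nil => simp
  | cons e l ih =>
    rw [listPoly_cons]
    refine ⟨(monic_X_sub_C _).mul ih.1, ?_⟩
    rw [(monic_X_sub_C _).natDegree_mul ih.1, natDegree_X_sub_C, ih.2, List.length_cons, add_comm]

theorem map_listPoly_cons {B : Type*} [Ring B] [Algebra F B]
    (φ : FreeAlgebra F (HasseEdge P) →ₐ[F] B) (e : HasseEdge P) (l : List (HasseEdge P)) :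
    (listPoly F (e :: l)).map (φ : _ →+* B) =
      (X - C (φ (FreeAlgebra.ι F e))) * (listPoly F l).map (φ : _ →+* B) := by
  rw [listPoly_cons, Polynomial.map_mul, Polynomial.map_sub, map_X, map_C]
  rfl

end ListPoly

variable (F : Type*) [Field F] {P : Type*} [PartialOrder P] [OrderBot P]

namespace PathToBot

theorem eq_bot_of_nil {v : P} (h : PathToBot v []) : v = ⊥ := by
  cases h; rfl

theorem isChain {v : P} {l : List (HasseEdge P)} (h : PathToBot v l) :
    l.IsChain (fun e f => e.head = f.tail) ∧ ∀ hl : l ≠ [],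
      (l.head hl).tail = v ∧ (l.getLast hl).head = ⊥ := by
  induction h with
  | nil => exact ⟨List.isChain_nil, fun h => absurd rfl h⟩
  | cons e h ih =>
    rename_i l
    refine ⟨List.isChain_cons.2 ⟨?_, ih.1⟩, fun _ => ⟨rfl, ?_⟩⟩
    · intro f hf
      cases l with
      | nil => simp at hf
      | cons g l =>
        obtain rfl : g = f := by simpa using hf
        exact (ih.2 (by simp)).1.symm
    · cases l with
      | nil => simpa using h.eq_bot_of_nil
      | cons g l =>
        rw [List.getLast_cons (by simp)]
        exact (ih.2 (by simp)).2

theorem ne_nil {v : P} {l : List (HasseEdge P)} (h : PathToBot v l) (hv : v ≠ ⊥) : l ≠ [] := by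
  rintro rfl
  exact hv h.eq_bot_of_nil

theorem eq_nil {l : List (HasseEdge P)} (h : PathToBot (⊥ : P) l) : l = [] := by
  generalize hv : (⊥ : P) = v at h
  cases h with
  | nil => rfl
  | cons e h =>
    have : e.head < e.tail := e.2.lt
    rw [← hv] at this
    exact absurd this not_lt_bot

theorem length [GradeMinOrder ℕ P] {v : P} {l : List (HasseEdge P)} (h : PathToBot v l) :
    l.length = grade ℕ v := by
  induction h with
  | nil => simp
  | cons e h ih =>
    rw [List.length_cons, ih]
    exact Nat.covBy_iff_add_one_eq.1 (e.2.grade ℕ)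

variable {F} in
theorem map_listPoly_eq {v : P} {l l' : List (HasseEdge P)} (h : PathToBot v l)
    (h' : PathToBot v l') :
    (listPoly F l).map (RingQuot.mkAlgHom F (Rel F P) : _ →+* SplittingAlgebra F P) =
      (listPoly F l').map (RingQuot.mkAlgHom F (Rel F P) : _ →+* SplittingAlgebra F P) := by
  by_cases hv : v = ⊥
  · subst hv
    rw [h.eq_nil, h'.eq_nil]
  · ext i
    rw [coeff_map, coeff_map]
    have hn := h.ne_nil hv
    have hn' := h'.ne_nil hv
    refine RingQuot.mkAlgHom_rel F (Rel.of_equivalent ⟨l, hn, h.isChain.1⟩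
      ⟨l', hn', h'.isChain.1⟩ ⟨?_, ?_⟩ i)
    · exact (h.isChain.2 hn).1.trans (h'.isChain.2 hn').1.symm
    · exact (h.isChain.2 hn).2.trans (h'.isChain.2 hn').2.symm

end PathToBot

theorem exists_pathToBot [WellFoundedLT P] [IsStronglyCoatomic P] (v : P) :
    ∃ l, PathToBot v l := by
  induction v using WellFoundedLT.induction with
  | _ v ih =>
  by_cases hv : v = ⊥
  · exact ⟨[], hv ▸ PathToBot.nil⟩
  · obtain ⟨w, -, hw⟩ := exists_le_covBy_of_lt (bot_lt_iff_ne_bot.2 hv)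
    obtain ⟨l, hl⟩ := ih w hw.lt
    exact ⟨_, PathToBot.cons ⟨(v, w), hw⟩ hl⟩

/-- The image of an edge in the splitting algebra. -/
def edge (e : HasseEdge P) : SplittingAlgebra F P :=
  RingQuot.mkAlgHom F (Rel F P) (FreeAlgebra.ι F e)

section Lift

variable {F} {B : Type*} [Ring B] [Algebra F B] {p : P → B[X]} (hm : ∀ v, (p v).Monic)
  {a : HasseEdge P → B} (ha : ∀ e, p e.tail = (X - C (a e)) * p e.head)

omit [OrderBot P] in
include ha in
theorem map_listPoly_mul (l : List (HasseEdge P)) (hl : l ≠ [])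
    (hc : l.IsChain fun e f => e.head = f.tail) :
    (listPoly F l).map (FreeAlgebra.lift F a : _ →+* B) * p (l.getLast hl).head =
      p (l.head hl).tail := by
  induction l with
  | nil => exact absurd rfl hl
  | cons e l ih =>
    rw [map_listPoly_cons, mul_assoc, FreeAlgebra.lift_ι_apply]
    cases l with
    | nil =>
      rw [listPoly_nil, Polynomial.map_one, one_mul]
      exact (ha e).symm
    | cons f l =>
      rw [List.isChain_cons_cons] at hc
      have := ih (by simp) hc.2
      rw [List.getLast_cons (by simp), this, List.head_cons, List.head_cons, ← hc.1]
      exact (ha e).symm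

-- Both path polynomials, multiplied on the right by the polynomial at the common head, give the
-- polynomial at the common tail; a monic polynomial can be cancelled.
omit [OrderBot P] in
include hm ha in
theorem lift_rel ⦃x y : FreeAlgebra F (HasseEdge P)⦄ (h : Rel F P x y) :
    FreeAlgebra.lift F a x = FreeAlgebra.lift F a y := by
  obtain ⟨π₁, π₂, ⟨ht, hh⟩, i⟩ := h
  have h1 := map_listPoly_mul (F := F) ha π₁.edges π₁.ne_nil π₁.chain
  have h2 := map_listPoly_mul (F := F) ha π₂.edges π₂.ne_nil π₂.chain
  simp only [HassePath.tail, HassePath.head] at ht hh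
  rw [ht, hh, ← h2] at h1
  have h3 := congrArg (fun p => coeff p i) ((hm _).isRegular.right h1)
  simp only [coeff_map] at h3
  exact h3

/-- A family of monic polynomials, one for each vertex, that differ by linear factors along the
edges gives a homomorphism from the splitting algebra. -/
def lift : SplittingAlgebra F P →ₐ[F] B :=
  RingQuot.liftAlgHom F ⟨FreeAlgebra.lift F a, lift_rel hm ha⟩

omit [OrderBot P] in
theorem lift_mk (x : FreeAlgebra F (HasseEdge P)) :
    lift hm ha (RingQuot.mkAlgHom F (Rel F P) x) = FreeAlgebra.lift F a x :=
  RingQuot.liftAlgHom_mkAlgHom_apply _ _ _ _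

include ha in
theorem PathToBot.map_lift (hb : p ⊥ = 1) {v : P} {l : List (HasseEdge P)} (h : PathToBot v l) :
    (listPoly F l).map (FreeAlgebra.lift F a : _ →+* B) = p v := by
  induction h with
  | nil => rw [listPoly_nil, Polynomial.map_one, hb]
  | cons e h ih =>
    rw [map_listPoly_cons, ih, FreeAlgebra.lift_ι_apply]
    exact (ha e).symm

end Lift

variable [Finite P]

/-- The monic polynomial over the splitting algebra attached to a vertex `v`: the product of the
factors `t - e` along any path from `v` to the bottom element. -/
def vertexPoly (v : P) : (SplittingAlgebra F P)[X] :=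
  (listPoly F (exists_pathToBot v).choose).map
    (RingQuot.mkAlgHom F (Rel F P) : _ →+* SplittingAlgebra F P)

variable {F} in
theorem vertexPoly_eq {v : P} {l : List (HasseEdge P)} (h : PathToBot v l) :
    vertexPoly F v = (listPoly F l).map
      (RingQuot.mkAlgHom F (Rel F P) : _ →+* SplittingAlgebra F P) :=
  (exists_pathToBot v).choose_spec.map_listPoly_eq h

variable {F} in
theorem lift_vertexPoly_coeff {B : Type*} [Ring B] [Algebra F B] {p : P → B[X]}
    (hm : ∀ v, (p v).Monic) {a : HasseEdge P → B}
    (ha : ∀ e, p e.tail = (X - C (a e)) * p e.head) (hb : p ⊥ = 1) (v : P) (i : ℕ) :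
    lift (F := F) hm ha ((vertexPoly F v).coeff i) = (p v).coeff i := by
  obtain ⟨l, hl⟩ := exists_pathToBot v
  rw [vertexPoly_eq hl, coeff_map, ← hl.map_lift (F := F) ha hb, coeff_map]
  exact lift_mk hm ha _

theorem vertexPoly_tail (e : HasseEdge P) :
    vertexPoly F e.tail = (X - C (edge F e)) * vertexPoly F e.head := by
  obtain ⟨l, hl⟩ := exists_pathToBot e.head
  rw [vertexPoly_eq (hl.cons e), vertexPoly_eq hl, map_listPoly_cons]
  rfl

variable [GradeMinOrder ℕ P]

/-- The element of the splitting algebra that a letter stands for. -/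
def letterValue (x : Letter P) : SplittingAlgebra F P := (vertexPoly F x.1).coeff x.2

/-- The product of the values of the letters of a word. -/
def wordValue (W : List (Letter P)) : SplittingAlgebra F P := (W.map (letterValue F)).prod

@[simp] theorem wordValue_nil : wordValue F ([] : List (Letter P)) = 1 := rfl

@[simp] theorem wordValue_cons (x : Letter P) (W : List (Letter P)) :
    wordValue F (x :: W) = letterValue F x * wordValue F W := by simp [wordValue]

@[simp] theorem wordValue_append (V W : List (Letter P)) :
    wordValue F (V ++ W) = wordValue F V * wordValue F W := by simp [wordValue]

theorem vertexPoly_coeff_mem (v : P) {i d : ℕ} (h : i + d = grade ℕ v) :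
    (vertexPoly F v).coeff i ∈ part F P d := by
  obtain ⟨l, hl⟩ := exists_pathToBot v
  rw [vertexPoly_eq hl, coeff_map]
  exact ⟨_, (listPoly_coeff F l).1 i d (by rw [h, hl.length]), rfl⟩

theorem vertexPoly_coeff_grade (v : P) : (vertexPoly F v).coeff (grade ℕ v) = 1 := by
  obtain ⟨l, hl⟩ := exists_pathToBot v
  rw [vertexPoly_eq hl, coeff_map, ← hl.length, ← (listPoly_monic F l).2,
    (listPoly_monic F l).1.coeff_natDegree, map_one]

theorem vertexPoly_coeff_of_lt (v : P) {i : ℕ} (h : grade ℕ v < i) :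
    (vertexPoly F v).coeff i = 0 := by
  obtain ⟨l, hl⟩ := exists_pathToBot v
  rw [vertexPoly_eq hl, coeff_map, (listPoly_coeff F l).2 i (by rwa [hl.length]), map_zero]

theorem wordValue_mem (W : List (Letter P)) : wordValue F W ∈ part F P (wordDegree W) := by
  induction W with
  | nil => exact SetLike.one_mem_graded _
  | cons x W ih =>
    rw [wordValue_cons, wordDegree_cons]
    refine SetLike.mul_mem_graded (vertexPoly_coeff_mem F _ ?_) ih
    rw [add_comm, x.degree_add]

/-- `Q` collects the factors `t - e` along a path from `v` down to `u`. -/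
theorem exists_vertexPoly_eq_mul {u v : P} (h : u ≤ v) :
    ∃ (Q : (SplittingAlgebra F P)[X]) (k : ℕ), grade ℕ v = grade ℕ u + k ∧ Q.natDegree ≤ k ∧
      vertexPoly F v = Q * vertexPoly F u := by
  induction v using WellFoundedLT.induction with
  | _ v ih =>
  rcases h.eq_or_lt with rfl | h
  · exact ⟨1, 0, by simp⟩
  · obtain ⟨w, huw, hw⟩ := exists_le_covBy_of_lt h
    obtain ⟨Q, k, hk, hd, e⟩ := ih w hw.lt huw
    obtain ⟨a, rfl, rfl⟩ : ∃ a : HasseEdge P, a.tail = v ∧ a.head = w := ⟨⟨(v, w), hw⟩, rfl, rfl⟩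
    refine ⟨(X - C (edge F a)) * Q, k + 1, ?_, ?_, ?_⟩
    · rw [← Nat.covBy_iff_add_one_eq.1 (hw.grade ℕ), hk, add_assoc]
    · rw [add_comm]
      exact natDegree_mul_le.trans (add_le_add (natDegree_X_sub_C_le _) hd)
    · rw [mul_assoc, ← e]
      exact vertexPoly_tail F a

/-! ### The weight filtration and the rewriting -/

/-- The span of the words of a given degree and bounded weight. -/
def weightFiltration (P : Type*) [PartialOrder P] [OrderBot P] [Finite P] [GradeMinOrder ℕ P]
    (d w : ℕ) : Submodule F (SplittingAlgebra F P) :=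
  Submodule.span F (wordValue F '' {W | wordDegree W = d ∧ wordWeight W ≤ w})

theorem weightFiltration_mono (d : ℕ) {w w' : ℕ} (h : w ≤ w') :
    weightFiltration F P d w ≤ weightFiltration F P d w' :=
  Submodule.span_mono (Set.image_mono fun _ hW => ⟨hW.1, hW.2.trans h⟩)

variable {F} in
theorem mul_mem_weightFiltration {d d' w w' : ℕ} {x y : SplittingAlgebra F P}
    (hx : x ∈ weightFiltration F P d w) (hy : y ∈ weightFiltration F P d' w') :
    x * y ∈ weightFiltration F P (d + d') (w + w') := by
  have h := Submodule.mul_mem_mul hx hy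
  rw [weightFiltration, weightFiltration, Submodule.span_mul_span] at h
  refine Submodule.span_mono ?_ h
  rintro _ ⟨_, ⟨V, hV, rfl⟩, _, ⟨W, hW, rfl⟩, rfl⟩
  refine ⟨V ++ W, ⟨?_, ?_⟩, wordValue_append F V W⟩
  · rw [wordDegree_append, hV.1, hW.1]
  · rw [wordWeight_append]
    exact add_le_add hV.2 hW.2

theorem wordValue_mem_weightFiltration (W : List (Letter P)) :
    wordValue F W ∈ weightFiltration F P (wordDegree W) (wordWeight W) :=
  Submodule.subset_span ⟨W, ⟨rfl, le_rfl⟩, rfl⟩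

theorem vertexPoly_coeff_mem_weightFiltration (v : P) {j d : ℕ} (h : j + d = grade ℕ v) :
    (vertexPoly F v).coeff j ∈
      weightFiltration F P d (∑ r ∈ Finset.Ioc j (grade ℕ v), r) := by
  rcases Nat.eq_zero_or_pos d with rfl | hd
  · rw [add_zero] at h
    rw [h, vertexPoly_coeff_grade, Finset.Ioc_self, Finset.sum_empty]
    exact wordValue_mem_weightFiltration F []
  · have := wordValue_mem_weightFiltration F [(⟨v, j, by omega⟩ : Letter P)]
    have e : grade ℕ v - j = d := by omega
    simpa [letterValue, wordWeight, Letter.weight, Letter.degree, e] using this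

-- Since `p_u` is monic, comparing coefficients at `b + grade u` expresses `Q_b` through a
-- coefficient of `p_v` and products of `Q_c`, `c > b`, with coefficients of `p_u`. Such a product
-- is light enough because the interval contributed by `p_u` has length `c - b` and lies no higher
-- than the missing interval from `grade u + b` to `grade u + c`.
variable {F} in
theorem quotient_coeff_mem {u v : P} {Q : (SplittingAlgebra F P)[X]} {k : ℕ}
    (hk : grade ℕ v = grade ℕ u + k) (hd : Q.natDegree ≤ k)
    (hQ : vertexPoly F v = Q * vertexPoly F u) (d : ℕ) : ∀ b, b + d = k → Q.coeff b ∈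
    weightFiltration F P d (∑ r ∈ Finset.Ioc (grade ℕ u + b) (grade ℕ v), r) := by
  induction d using Nat.strong_induction_on with
  | _ d ih =>
  intro b hb
  have h := congrArg (fun p => coeff p (b + grade ℕ u)) hQ
  simp only [coeff_mul] at h
  rw [← Finset.add_sum_erase _ _ (Finset.HasAntidiagonal.mem_antidiagonal.2 rfl : (b, grade ℕ u) ∈ _)] at h
  simp only [vertexPoly_coeff_grade, mul_one] at h
  rw [← sub_eq_iff_eq_add.2 h, add_comm b]
  refine Submodule.sub_mem _ (vertexPoly_coeff_mem_weightFiltration F v (by omega))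
    (Submodule.sum_mem _ ?_)
  rintro ⟨c, c'⟩ hc
  rw [Finset.mem_erase, Finset.HasAntidiagonal.mem_antidiagonal] at hc
  obtain ⟨hne, hc⟩ := hc
  simp only at hc ⊢
  rcases lt_or_ge k c with hkc | hkc
  · rw [coeff_eq_zero_of_natDegree_lt (hd.trans_lt hkc), zero_mul]
    exact Submodule.zero_mem _
  rcases lt_trichotomy c b with hcb | rfl | hcb
  · rw [vertexPoly_coeff_of_lt F u (by omega), mul_zero]
    exact Submodule.zero_mem _
  · exact (hne (by rw [show c' = grade ℕ u by omega])).elim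
  · have m1 := ih (k - c) (by omega) c (by omega)
    have m2 := vertexPoly_coeff_mem_weightFiltration F u (j := c') (d := c - b) (by omega)
    have m := mul_mem_weightFiltration m1 m2
    rw [show k - c + (c - b) = d by omega] at m
    refine weightFiltration_mono F d ?_ m
    rw [← Finset.sum_Ioc_consecutive _ (by omega : grade ℕ u + b ≤ grade ℕ u + c)
      (by omega : grade ℕ u + c ≤ grade ℕ v), add_comm]
    refine Nat.add_le_add_right ?_ _
    have := sum_Ioc_add c' (c - b) b
    rw [show c' + b = grade ℕ u + b - (c - b) by omega,
      show c' + (c - b) + b = grade ℕ u + b by omega,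
      show c' + (c - b) = grade ℕ u by omega] at this
    rw [show grade ℕ u = c' + (c - b) by omega]
    have := @sum_Ioc_lt c' (c - b) (c' + (c - b) + b) (by omega) (by omega)
    rw [show c' + (c - b) + b + (c - b) = c' + (c - b) + c by omega] at this
    exact this.le

/-- As `x.2 = grade u`, the leading coefficient of `p_u` makes `Q_0` a summand of `x`, so `Q_0`
times `y` occurs in both terms and cancels. What remains involves `Q_b` with `b > 0`, where an
interval of length `b` has slid strictly downwards. -/
theorem letterValue_mul_sub_mem {x y : Letter P} (h : x.Covers y) :
    letterValue F x * letterValue F y - (vertexPoly F x.1).coeff y.2 ∈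
      weightFiltration F P (x.degree + y.degree) (x.weight + y.weight - 1) := by
  obtain ⟨v, j⟩ := x
  obtain ⟨u, i⟩ := y
  obtain ⟨huv, hj⟩ := h
  simp only at huv hj
  obtain ⟨Q, k, hk, hd, hQ⟩ := exists_vertexPoly_eq_mul F huv.le
  have hq := quotient_coeff_mem hk hd hQ
  have hv : ∀ m, (vertexPoly F v).coeff m =
      Q.coeff 0 * (vertexPoly F u).coeff m + ∑ p ∈ (Finset.HasAntidiagonal.antidiagonal m).erase (0, m),
        Q.coeff p.1 * (vertexPoly F u).coeff p.2 := by
    intro m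
    rw [hQ, coeff_mul, ← Finset.add_sum_erase _ _
      (Finset.HasAntidiagonal.mem_antidiagonal.2 (zero_add m) : (0, m) ∈ _)]
  have e1 : letterValue F (⟨v, j⟩ : Letter P) = Q.coeff 0 +
      ∑ p ∈ (Finset.HasAntidiagonal.antidiagonal (grade ℕ u)).erase (0, grade ℕ u),
        Q.coeff p.1 * (vertexPoly F u).coeff p.2 := by
    rw [letterValue, ← hj, hv, vertexPoly_coeff_grade, mul_one]
  have hi := i.2
  simp only [letterValue] at e1 ⊢
  rw [e1, hv i, add_mul, add_sub_add_left_eq_sub, Finset.sum_mul]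
  simp only [Letter.weight, Letter.degree, ← hj]
  have hw : ∀ b, 0 < b → b ≤ k → ∀ a, a < grade ℕ u →
      ∑ r ∈ Finset.Ioc (grade ℕ u + b) (grade ℕ v), r + ∑ r ∈ Finset.Ioc a (a + b), r <
        ∑ r ∈ Finset.Ioc (grade ℕ u) (grade ℕ v), r := by
    intro b hb hbk a ha
    rw [← Finset.sum_Ioc_consecutive _ (by omega : grade ℕ u ≤ grade ℕ u + b)
      (by omega : grade ℕ u + b ≤ grade ℕ v), add_comm]
    exact Nat.add_lt_add_right (sum_Ioc_lt hb ha) _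
  refine Submodule.sub_mem _ (Submodule.sum_mem _ ?_) (Submodule.sum_mem _ ?_)
  all_goals
    rintro ⟨b, b'⟩ hb
    rw [Finset.mem_erase, Finset.HasAntidiagonal.mem_antidiagonal] at hb
    obtain ⟨hne, hb⟩ := hb
    simp only at hb ⊢
    have hb0 : 0 < b := by
      rcases Nat.eq_zero_or_pos b with rfl | h
      · exact (hne (by rw [← hb, zero_add])).elim
      · exact h
    rcases lt_or_ge k b with hkb | hkb
    · rw [coeff_eq_zero_of_natDegree_lt (hd.trans_lt hkb)]
      simp
    have m1 := hq (k - b) b (by omega)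
    have m2 := vertexPoly_coeff_mem_weightFiltration F u (j := b') (d := grade ℕ u - b') (by omega)
    have hlt := hw b hb0 hkb b' (by omega)
  · have m3 := vertexPoly_coeff_mem_weightFiltration F u (j := i) (d := grade ℕ u - i) (by omega)
    have m := mul_mem_weightFiltration (mul_mem_weightFiltration m1 m2) m3
    rw [show k - b + (grade ℕ u - b') + (grade ℕ u - i) =
      grade ℕ v - grade ℕ u + (grade ℕ u - i) by omega] at m
    refine weightFiltration_mono F _ ?_ m
    rw [show b' + b = grade ℕ u by omega] at hlt
    omega
  · have m := mul_mem_weightFiltration m1 m2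
    rw [show k - b + (grade ℕ u - b') = grade ℕ v - grade ℕ u + (grade ℕ u - i) by omega] at m
    refine weightFiltration_mono F _ ?_ m
    rw [show b' + b = i by omega] at hlt
    rw [← Finset.sum_Ioc_consecutive (fun r => r) (by omega : b' ≤ i) hi.le]
    omega

/-- Induction on weight, then on length: merging a covering pair keeps degree and weight but
shortens the word, and the error has smaller weight. -/
theorem wordValue_mem_span_normal (w : ℕ) : ∀ (n : ℕ) (W : List (Letter P)), wordWeight W = w →
    W.length = n → wordValue F W ∈
      Submodule.span F (wordValue F '' {V | IsNormal V ∧ wordDegree V = wordDegree W}) := by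
  induction w using Nat.strong_induction_on with
  | _ w ihw =>
  intro n
  induction n with
  | zero =>
    intro W _ hn
    rw [List.length_eq_zero_iff.1 hn]
    exact Submodule.subset_span ⟨[], ⟨List.isChain_nil, rfl⟩, rfl⟩
  | succ n ihn =>
    intro W hw hn
    by_cases hW : IsNormal W
    · exact Submodule.subset_span ⟨W, ⟨hW, rfl⟩, rfl⟩
    obtain ⟨U, x, y, V, rfl, hxy⟩ := exists_covers_of_not_isNormal hW
    have hlt : (y.2 : ℕ) < grade ℕ x.1 := y.2.2.trans (grade_strictMono hxy.1)
    -- The intervals of `x` and `y` abut at `grade y.1 = x.2`; their union is the interval of `z`,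
    -- so weights and degrees add.
    let z : Letter P := ⟨x.1, y.2, hlt⟩
    have hsum : z.weight = x.weight + y.weight := by
      simp only [Letter.weight, z, ← hxy.2]
      rw [add_comm, Finset.sum_Ioc_consecutive _ y.2.2.le (grade_mono hxy.1.le)]
    have hdeg : z.degree = x.degree + y.degree := by
      have := grade_strictMono (𝕆 := ℕ) hxy.1
      have h2 := y.2.2
      simp only [Letter.degree, z, ← hxy.2]
      omega
    have hz := ihn (U ++ z :: V) (by
        simp only [wordWeight_append, wordWeight_cons] at hw ⊢
        omega) (by
        simp only [List.length_append, List.length_cons] at hn ⊢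
        omega)
    have e : wordDegree (U ++ z :: V) = wordDegree (U ++ x :: y :: V) := by
      simp only [wordDegree_append, wordDegree_cons]
      omega
    rw [e] at hz
    have hr : wordValue F U * (letterValue F x * letterValue F y - letterValue F z) *
        wordValue F V ∈ weightFiltration F P (wordDegree (U ++ x :: y :: V)) (w - 1) := by
      have := mul_mem_weightFiltration (mul_mem_weightFiltration
        (wordValue_mem_weightFiltration F U) (letterValue_mul_sub_mem F hxy))
        (wordValue_mem_weightFiltration F V)
      have hx := x.weight_pos
      simp only [wordWeight_append, wordWeight_cons] at hw
      convert! this using 2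
      · simp only [wordDegree_append, wordDegree_cons]
        omega
      · omega
    have hle : weightFiltration F P (wordDegree (U ++ x :: y :: V)) (w - 1) ≤
        Submodule.span F (wordValue F ''
          {V' | IsNormal V' ∧ wordDegree V' = wordDegree (U ++ x :: y :: V)}) := by
      refine Submodule.span_le.2 ?_
      rintro _ ⟨W', ⟨hd', hw'⟩, rfl⟩
      have hx := x.weight_pos
      simp only [wordWeight_append, wordWeight_cons] at hw
      have := ihw (wordWeight W') (by omega) _ W' rfl rfl
      rwa [hd'] at this
    have := Submodule.add_mem _ (hle hr) hz
    convert! this using 1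
    simp only [wordValue_append, wordValue_cons]
    exact mul_mul_mul_eq_add _ _ _ _ _

/-- An edge is the difference of the subleading coefficients of the polynomials at its two ends, so
letters of degree one already give all edges. -/
theorem part_eq_span_words (d : ℕ) : part F P d =
    Submodule.span F (wordValue F '' {W : List (Letter P) | wordDegree W = d}) := by
  apply le_antisymm
  · have hmul : ∀ a b, Submodule.span F (wordValue F '' {W : List (Letter P) | wordDegree W = a}) *
        Submodule.span F (wordValue F '' {W : List (Letter P) | wordDegree W = b}) ≤
        Submodule.span F (wordValue F '' {W : List (Letter P) | wordDegree W = a + b}) := by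
      intro a b
      rw [Submodule.span_mul_span]
      refine Submodule.span_mono ?_
      rintro _ ⟨_, ⟨V, hV, rfl⟩, _, ⟨W, hW, rfl⟩, rfl⟩
      rw [Set.mem_ofPred_eq] at hV hW
      exact ⟨V ++ W, by simp [hV, hW], wordValue_append F V W⟩
    have hone : Submodule.map (RingQuot.mkAlgHom F (Rel F P)).toLinearMap
        (Submodule.span F (Set.range (FreeAlgebra.ι F))) ≤
        Submodule.span F (wordValue F '' {W : List (Letter P) | wordDegree W = 1}) := by
      rw [Submodule.map_span_le]
      rintro _ ⟨e, rfl⟩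
      have hc : grade ℕ e.head + 1 = grade ℕ e.tail := Nat.covBy_iff_add_one_eq.1 (e.2.grade ℕ)
      have hletter : ∀ (v : P) (j : ℕ), j + 1 = grade ℕ v → (vertexPoly F v).coeff j ∈
          Submodule.span F (wordValue F '' {W : List (Letter P) | wordDegree W = 1}) := by
        intro v j hj
        refine Submodule.subset_span ⟨[⟨v, j, by omega⟩], ?_, by simp [letterValue]⟩
        simp [Letter.degree, ← hj]
      have h := (congrArg (fun p => coeff p (grade ℕ e.head)) (vertexPoly_tail F e)).trans
        (coeff_X_sub_C_mul _ _ _)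
      simp only [vertexPoly_coeff_grade, mul_one] at h
      change edge F e ∈ _
      rw [← sub_eq_iff_eq_add.2 (sub_eq_iff_eq_add'.1 h.symm)]
      refine Submodule.sub_mem _ ?_ (hletter _ _ hc)
      -- A head of grade `0` has no subleading coefficient and contributes `0`.
      rcases h0 : grade ℕ e.head with _ | j
      · simp
      · rw [coeff_X_mul]
        exact hletter _ _ h0.symm
    induction d with
    | zero =>
      rw [part, freePart, pow_zero, Submodule.map_one, Submodule.one_le]
      exact Submodule.subset_span ⟨[], rfl, rfl⟩
    | succ d ih =>
      rw [part, freePart] at ih ⊢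
      rw [pow_succ, Submodule.map_mul]
      exact (mul_le_mul' ih hone).trans (hmul d 1)
  · rw [Submodule.span_le]
    rintro _ ⟨W, rfl, rfl⟩
    exact wordValue_mem F W

theorem part_eq_span_normal (d : ℕ) : part F P d =
    Submodule.span F (wordValue F '' {W : List (Letter P) | IsNormal W ∧ wordDegree W = d}) := by
  rw [part_eq_span_words]
  refine le_antisymm (Submodule.span_le.2 ?_)
    (Submodule.span_mono (Set.image_mono fun W hW => hW.2))
  rintro _ ⟨W, rfl, rfl⟩
  exact wordValue_mem_span_normal F _ _ W rfl rfl

end Spanning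

/-! ### Monic polynomials as linear recurrences on sequences -/

section SequenceAction

open Polynomial

variable {F M : Type*} [Field F] [AddCommGroup M] [Module F M]

/-- The shift of sequences. -/
def seqShift (F M : Type*) [Field F] [AddCommGroup M] [Module F M] : Module.End F (ℕ → M) :=
  LinearMap.funLeft F M Nat.succ

/-- Endomorphisms act on sequences termwise. -/
def termwise (F M : Type*) [Field F] [AddCommGroup M] [Module F M] :
    Module.End F M →+* Module.End F (ℕ → M) where
  toFun f := f.compLeft ℕ
  map_one' := rfl
  map_mul' _ _ := rfl
  map_zero' := rfl
  map_add' _ _ := rfl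

/-- The action of polynomials over the endomorphism ring on sequences, where the variable acts as
the shift. -/
def seqAction (F M : Type*) [Field F] [AddCommGroup M] [Module F M] :
    (Module.End F M)[X] →+* Module.End F (ℕ → M) :=
  eval₂RingHom' (termwise F M) (seqShift F M) fun _ => rfl

theorem seqShift_pow_apply (s : ℕ → M) (j i : ℕ) : (seqShift F M ^ j) s i = s (i + j) := by
  induction j generalizing s i with
  | zero => rfl
  | succ j ih =>
    rw [pow_succ, Module.End.mul_apply, ih]
    rfl

theorem seqAction_apply (p : (Module.End F M)[X]) {n : ℕ} (h : p.natDegree < n) (s : ℕ → M)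
    (i : ℕ) : seqAction F M p s i = ∑ j ∈ Finset.range n, p.coeff j (s (i + j)) := by
  have e : seqAction F M p =
      ∑ j ∈ Finset.range n, termwise F M (p.coeff j) * seqShift F M ^ j :=
    eval₂_eq_sum_range' (termwise F M) h (seqShift F M)
  rw [e, LinearMap.sum_apply, Finset.sum_apply]
  refine Finset.sum_congr rfl fun j _ => ?_
  rw [Module.End.mul_apply, ← seqShift_pow_apply (F := F) s j i]
  rfl

/-- The linear combination of `d` vectors given by the lowest `d` coefficients of a polynomial. -/
def lowerPart (d : ℕ) (p : (Module.End F M)[X]) : (Fin d → M) →ₗ[F] M :=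
  ∑ j : Fin d, p.coeff j ∘ₗ LinearMap.proj j

theorem lowerPart_apply (d : ℕ) (p : (Module.End F M)[X]) (x : Fin d → M) :
    lowerPart d p x = ∑ j : Fin d, p.coeff j (x j) := by
  simp [lowerPart]

/-- The first `d` terms of a sequence. -/
def initial (F M : Type*) [Field F] [AddCommGroup M] [Module F M] (d : ℕ) :
    (ℕ → M) →ₗ[F] (Fin d → M) :=
  LinearMap.funLeft F M Fin.val

@[simp] theorem initial_apply (d : ℕ) (s : ℕ → M) (j : Fin d) : initial F M d s j = s j := rfl

theorem initial_congr {d : ℕ} {s t : ℕ → M} (h : ∀ j < d, s j = t j) :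
    initial F M d s = initial F M d t :=
  funext fun j => h j j.2

section Monic

variable {p : (Module.End F M)[X]} {d : ℕ} (h1 : p.coeff d = 1) (hd : p.natDegree ≤ d)

include h1 hd

theorem seqAction_monic_apply (s : ℕ → M) (i : ℕ) :
    seqAction F M p s i =
      lowerPart d p (initial F M d ((seqShift F M ^ i) s)) + s (i + d) := by
  rw [seqAction_apply p (Nat.lt_succ_of_le hd), Finset.sum_range_succ, h1, lowerPart_apply,
    ← Fin.sum_univ_eq_sum_range (fun j => p.coeff j (s (i + j)))]
  congr 1
  refine Finset.sum_congr rfl fun j _ => ?_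
  rw [initial_apply, seqShift_pow_apply, add_comm]

theorem seqAction_eq_zero_iff (s : ℕ → M) : s ∈ LinearMap.ker (seqAction F M p) ↔
    ∀ i, s (i + d) = -lowerPart d p (initial F M d ((seqShift F M ^ i) s)) := by
  rw [LinearMap.mem_ker, funext_iff]
  refine forall_congr' fun i => ?_
  rw [seqAction_monic_apply h1 hd, Pi.zero_apply, add_comm, add_eq_zero_iff_eq_neg]

theorem eq_of_initial_eq {s t : ℕ → M} (hs : s ∈ LinearMap.ker (seqAction F M p))
    (ht : t ∈ LinearMap.ker (seqAction F M p))
    (h : initial F M d s = initial F M d t) : s = t := by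
  rw [seqAction_eq_zero_iff h1 hd] at hs ht
  funext i
  induction i using Nat.strong_induction_on with
  | _ i ih =>
  rcases lt_or_ge i d with hi | hi
  · exact congrFun h ⟨i, hi⟩
  · obtain ⟨k, rfl⟩ := Nat.exists_eq_add_of_le' hi
    rw [hs, ht]
    congr 2
    refine initial_congr fun j hj => ?_
    rw [seqShift_pow_apply, seqShift_pow_apply]
    exact ih _ (by omega)

theorem exists_initial_eq (x : Fin d → M) :
    ∃ s ∈ LinearMap.ker (seqAction F M p), initial F M d s = x := by
  have key : ∃ s : ℕ → M, ∀ i, s i = if h : i < d then x ⟨i, h⟩ else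
      -lowerPart d p fun j => s (i - d + j) := by
    let G : ∀ i : ℕ, (∀ j < i, M) → M := fun i s => if h : i < d then x ⟨i, h⟩ else
      -lowerPart d p fun j => s (i - d + j) (by omega)
    exact ⟨fun i => WellFounded.fix Nat.lt_wfRel.wf G i, fun i => WellFounded.fix_eq _ G i⟩
  obtain ⟨s, hs⟩ := key
  refine ⟨s, (seqAction_eq_zero_iff h1 hd s).2 fun i => ?_, ?_⟩
  · rw [hs, dif_neg (by omega)]
    congr 2
    funext j
    rw [initial_apply, seqShift_pow_apply]
    congr 1
    omega
  · funext j
    rw [initial_apply, hs, dif_pos j.2]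

end Monic

/-- The variable is central, so the shift commutes with the action of `p`. -/
theorem seqShift_pow_mem_ker {p : (Module.End F M)[X]} {s : ℕ → M}
    (hs : s ∈ LinearMap.ker (seqAction F M p)) (i : ℕ) :
    (seqShift F M ^ i) s ∈ LinearMap.ker (seqAction F M p) := by
  have hX : seqAction F M (X ^ i) = seqShift F M ^ i := by
    rw [map_pow]
    exact congrArg (· ^ i) (eval₂_X (termwise F M) (seqShift F M))
  rw [LinearMap.mem_ker] at hs ⊢
  rw [← hX, ← Module.End.mul_apply, ← map_mul, ← X_pow_mul, map_mul, Module.End.mul_apply, hs,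
    map_zero]

/-- Nested solution spaces of consecutive orders come from a right factorization. -/
theorem exists_eq_X_sub_C_mul {p q : (Module.End F M)[X]} {d : ℕ} (hp : p.coeff (d + 1) = 1)
    (hpd : p.natDegree ≤ d + 1) (hq : q.coeff d = 1) (hqd : q.natDegree ≤ d)
    (h : LinearMap.ker (seqAction F M q) ≤ LinearMap.ker (seqAction F M p)) :
    ∃ a, p = (X - C a) * q := by
  -- The value of `a` is forced by the coefficient of degree `d`. The remainder `r` then has only
  -- coefficients below `d` and kills all solutions of `q`.
  refine ⟨(X * q - p).coeff d, ?_⟩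
  set a := (X * q - p).coeff d with ha
  rw [← sub_eq_zero]
  set r := p - (X - C a) * q with hr
  have hc : ∀ i, r.coeff i = p.coeff i - ((X * q).coeff i - a * q.coeff i) := by
    intro i
    rw [hr, coeff_sub, sub_mul, coeff_sub, coeff_C_mul]
  have hhigh : ∀ i, d ≤ i → r.coeff i = 0 := by
    intro i hi
    rw [hc]
    rcases hi.eq_or_lt with rfl | hi
    · rw [hq, ha, coeff_sub, mul_one]
      abel
    · obtain ⟨k, rfl⟩ := Nat.exists_eq_add_of_lt hi
      rw [coeff_X_mul, coeff_eq_zero_of_natDegree_lt (by omega : q.natDegree < d + k + 1)]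
      cases k with
      | zero => rw [add_zero, hp, hq]; simp
      | succ k =>
        rw [coeff_eq_zero_of_natDegree_lt (by omega : q.natDegree < d + (k + 1)),
          coeff_eq_zero_of_natDegree_lt (by omega : p.natDegree < d + (k + 1) + 1)]
        simp
  have hdeg : r.natDegree < d + 1 :=
    Nat.lt_succ_of_le (natDegree_le_iff_coeff_eq_zero.2 fun i hi => hhigh i (le_of_lt hi))
  have hker : ∀ s ∈ LinearMap.ker (seqAction F M q), seqAction F M r s = 0 := by
    intro s hs
    have hs' := h hs
    rw [LinearMap.mem_ker] at hs hs'
    rw [hr, map_sub, map_mul, LinearMap.sub_apply, Module.End.mul_apply, hs, hs', map_zero,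
      sub_zero]
  ext1 i
  rcases le_or_gt d i with hi | hi
  · rw [hhigh i hi, coeff_zero]
  refine LinearMap.ext fun m => ?_
  -- Initial values of solutions of `q` are arbitrary; this choice isolates the `i`-th coefficient
  -- of `r` at `m`.
  obtain ⟨s, hs, hx⟩ := exists_initial_eq hq hqd (Pi.single (⟨i, hi⟩ : Fin d) m)
  have h0 := congrFun (hker s hs) 0
  rw [seqAction_apply r hdeg, Finset.sum_range_succ, hhigh d le_rfl, LinearMap.zero_apply,
    add_zero, Finset.sum_eq_single i] at h0
  · have := congrFun hx ⟨i, hi⟩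
    rw [initial_apply, Pi.single_eq_same] at this
    rw [zero_add] at h0
    rw [coeff_zero, LinearMap.zero_apply, ← this]
    exact h0
  · intro j hj hne
    have := congrFun hx ⟨j, Finset.mem_range.1 hj⟩
    rw [initial_apply, Pi.single_eq_of_ne (by simpa [Fin.ext_iff] using hne)] at this
    rw [zero_add]
    exact (congrArg _ this).trans (map_zero _)
  · exact fun hi' => absurd (Finset.mem_range.2 hi) hi'

end SequenceAction

/-! ### The representation on words and linear independence -/

section Representation

open Polynomial

variable {F : Type*} [Field F] {P : Type*} [PartialOrder P] [GradeMinOrder ℕ P]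
  {M : Type*} [AddCommGroup M] [Module F M] (b : Module.Basis (List (Letter P)) F M)

/-- The elements without a component at a word starting at `v`. -/
def avoiding (v : P) : Submodule F M where
  carrier := {m | ∀ i W, b.repr m (⟨v, i⟩ :: W) = 0}
  add_mem' hm hn i W := by rw [map_add, Finsupp.add_apply, hm, hn, add_zero]
  zero_mem' _ _ := by rw [map_zero, Finsupp.zero_apply]
  smul_mem' c m hm i W := by rw [map_smul, Finsupp.smul_apply, hm, smul_zero]

/-- Prepending letters of a vertex `v`, one for each coefficient. -/
def prepend (v : P) : (Fin (grade ℕ v) → M) →ₗ[F] M :=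
  ∑ j, b.constr F (fun W => b (⟨v, j⟩ :: W)) ∘ₗ LinearMap.proj j

theorem prepend_apply (v : P) (x : Fin (grade ℕ v) → M) :
    prepend b v x = ∑ j, b.constr F (fun W => b (⟨v, j⟩ :: W)) (x j) := by
  simp [prepend]

theorem repr_constr_cons (x : Letter P) (m : M) :
    b.repr (b.constr F (fun W => b (x :: W)) m) =
      Finsupp.mapDomain (List.cons x) (b.repr m) := by
  have : b.repr.toLinearMap ∘ₗ b.constr F (fun W => b (x :: W)) =
      Finsupp.lmapDomain F F (List.cons x) ∘ₗ b.repr.toLinearMap :=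
    b.ext fun W => by simp
  exact LinearMap.congr_fun this m

theorem repr_prepend_cons (v : P) (x : Fin (grade ℕ v) → M) (j : Fin (grade ℕ v))
    (W : List (Letter P)) : b.repr (prepend b v x) (⟨v, j⟩ :: W) = b.repr (x j) W := by
  rw [prepend_apply, map_sum, Finsupp.finsetSum_apply, Finset.sum_eq_single j]
  · rw [repr_constr_cons]
    exact Finsupp.mapDomain_apply List.cons_injective _ _
  · intro k _ hk
    rw [repr_constr_cons]
    refine Finsupp.mapDomain_of_notMem_range _ _ ?_
    rintro ⟨V, hV⟩
    rw [List.cons.injEq, Sigma.mk.injEq] at hV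
    exact hk (eq_of_heq hV.1.2)
  · simp

theorem prepend_mem_avoiding {u v : P} (h : u ≠ v) (x : Fin (grade ℕ v) → M) :
    prepend b v x ∈ avoiding b u := by
  intro i W
  rw [prepend_apply, map_sum, Finsupp.finsetSum_apply]
  refine Finset.sum_eq_zero fun k _ => ?_
  rw [repr_constr_cons]
  refine Finsupp.mapDomain_of_notMem_range _ _ ?_
  rintro ⟨V, hV⟩
  rw [List.cons.injEq, Sigma.mk.injEq] at hV
  exact h hV.1.1.symm

theorem prepend_single (v : P) (j : Fin (grade ℕ v)) (W : List (Letter P)) :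
    prepend b v (Pi.single j (b W)) = b (⟨v, j⟩ :: W) := by
  rw [prepend_apply, Finset.sum_eq_single j]
  · rw [Pi.single_eq_same, Module.Basis.constr_basis]
  · intro k _ hk
    rw [Pi.single_eq_of_ne hk, map_zero]
  · simp

/-- The tuples of coefficients that prepending letters of `v` leaves normal. -/
def normalTuples (v : P) : Submodule F (Fin (grade ℕ v) → M) :=
  ⨅ (u : P) (h : u < v),
    (avoiding b u).comap (LinearMap.proj (⟨grade ℕ u, grade_strictMono h⟩ : Fin (grade ℕ v)))

variable {b} in
theorem mem_normalTuples {v : P} {x : Fin (grade ℕ v) → M} :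
    x ∈ normalTuples b v ↔
      ∀ u (h : u < v), x ⟨grade ℕ u, grade_strictMono h⟩ ∈ avoiding b u := by
  simp [normalTuples]

/-- The sum of the solution spaces below `v`. -/
def solutionsBelow (p : P → (Module.End F M)[X]) (v : P) : Submodule F (ℕ → M) :=
  ⨆ w : {w // w < v}, LinearMap.ker (seqAction F _ (p w))

/-- The polynomial `q` extends the recurrences below `v`, with solution space `U`, to a recurrence
of order `grade v`, freely apart from the compatibility. -/
structure IsFreeExtension (v : P) (U : Submodule F (ℕ → M)) (q : (Module.End F M)[X]) : Prop where
  coeff_grade : q.coeff (grade ℕ v) = 1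
  natDegree_le : q.natDegree ≤ grade ℕ v
  le_ker : U ≤ LinearMap.ker (seqAction F _ q)
  lowerPart_mem : ∀ x u, ¬ u ≤ v → lowerPart (grade ℕ v) q x ∈ avoiding b u
  exists_of_mem : ∀ x, lowerPart (grade ℕ v) q x ∈ avoiding b v →
    ∃ s ∈ U, initial F _ (grade ℕ v) s = x
  lowerPart_normal : ∀ x ∈ normalTuples b v, lowerPart (grade ℕ v) q x = prepend b v x

section Step

variable {b} {p : P → (Module.End F M)[X]} {v : P}

omit [GradeMinOrder ℕ P] in
theorem ker_le_solutionsBelow {w : P} (h : w < v) :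
    LinearMap.ker (seqAction F _ (p w)) ≤ solutionsBelow p v :=
  le_iSup (fun w : {w // w < v} => LinearMap.ker (seqAction F _ (p w))) ⟨w, h⟩

theorem IsFreeExtension.apply_mem {U : Submodule F (ℕ → M)}
    {q : (Module.End F M)[X]} (h : IsFreeExtension b v U q) {s : ℕ → M}
    (hs : s ∈ LinearMap.ker (seqAction F _ q)) {i : ℕ} (hi : grade ℕ v ≤ i) {u : P}
    (hu : ¬ u ≤ v) : s i ∈ avoiding b u := by
  obtain ⟨k, rfl⟩ := Nat.exists_eq_add_of_le' hi
  rw [(seqAction_eq_zero_iff h.coeff_grade h.natDegree_le s).1 hs k]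
  exact neg_mem (h.lowerPart_mem _ u hu)

variable (hp : ∀ w < v, IsFreeExtension b w (solutionsBelow p w) (p w))

include hp

/-- A solution below `v` whose term of index `grade u` has no component at the words starting at
`u`, for all `u < v`, vanishes. -/
theorem eq_zero_of_mem_avoiding {s : ℕ → M} (hs : s ∈ solutionsBelow p v)
    (h : ∀ u < v, s (grade ℕ u) ∈ avoiding b u) : s = 0 := by
  classical
  -- Descent on the largest grade of a vertex contributing to `s`: each top summand is moved into
  -- solution spaces of lower grade.
  have key : ∀ r, s ∈ (⨆ w : {w // w < v ∧ grade ℕ w < r},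
      LinearMap.ker (seqAction F _ (p w)) : Submodule F (ℕ → M)) → s = 0 := by
    intro r
    induction r with
    | zero =>
      intro hs
      have : IsEmpty {w // w < v ∧ grade ℕ w < 0} := ⟨fun w => absurd w.2.2 (Nat.not_lt_zero _)⟩
      rwa [iSup_of_empty, Submodule.mem_bot] at hs
    | succ r ih =>
      intro hs
      apply ih
      obtain ⟨f, hf, rfl⟩ := (Submodule.mem_iSup_iff_exists_finsupp _ _).1 hs
      refine Submodule.sum_mem _ fun w _ => ?_
      obtain ⟨w, hwv, hwr⟩ := w
      rcases Nat.lt_succ_iff_lt_or_eq.1 hwr with hlt | rfl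
      · exact Submodule.mem_iSup_of_mem ⟨w, hwv, hlt⟩ (hf ⟨w, hwv, hwr⟩)
      · have hw := hp w hwv
        have hfw := hf ⟨w, hwv, hwr⟩
        -- The other summands belong to vertices `u` of grade at most `grade w` with `¬ w ≤ u`, so
        -- their terms at this index avoid `w`; since the total does too, so does the summand of
        -- `w`.
        have hfr : f ⟨w, hwv, hwr⟩ (grade ℕ w) ∈ avoiding b w := by
          have h1 := h w hwv
          rw [Finsupp.sum, Finset.sum_apply] at h1
          by_cases hmem : (⟨w, hwv, hwr⟩ : {u // u < v ∧ grade ℕ u < grade ℕ w + 1}) ∈ f.support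
          · rw [← Finset.add_sum_erase _ _ hmem] at h1
            refine (Submodule.add_mem_iff_left _ (Submodule.sum_mem _ ?_)).1 h1
            rintro ⟨u, huv, hur⟩ hu
            refine (hp u huv).apply_mem (hf ⟨u, huv, hur⟩) (Nat.le_of_lt_succ hur) fun hle => ?_
            rcases hle.eq_or_lt with rfl | hlt
            · simp at hu
            · have : grade ℕ w < grade ℕ u := grade_strictMono hlt
              omega
          · rw [Finsupp.notMem_support_iff.1 hmem]
            exact Submodule.zero_mem _
        have hlow : lowerPart (grade ℕ w) (p w)
            (initial F _ (grade ℕ w) (f ⟨w, hwv, hwr⟩)) ∈ avoiding b w := by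
          have h2 := (seqAction_eq_zero_iff hw.coeff_grade hw.natDegree_le _).1 hfw 0
          rw [zero_add, pow_zero, Module.End.one_apply] at h2
          rw [h2] at hfr
          exact neg_mem_iff.1 hfr
        -- The summand of `w` has the initial values of a solution from below `w`, hence equals it.
        obtain ⟨t, ht, hti⟩ := hw.exists_of_mem _ hlow
        have := eq_of_initial_eq hw.coeff_grade hw.natDegree_le hfw (hw.le_ker ht) hti.symm
        rw [this]
        refine (iSup_le fun u => ?_ : solutionsBelow p w ≤ _) ht
        have hlt : grade ℕ u.1 < grade ℕ w := grade_strictMono u.2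
        exact le_iSup (fun w' : {w' // w' < v ∧ grade ℕ w' < grade ℕ w} =>
          LinearMap.ker (seqAction F _ (p w'))) ⟨u.1, u.2.trans hwv, hlt⟩
  refine key (grade ℕ v) ((iSup_le fun u => ?_ : solutionsBelow p v ≤ _) hs)
  exact le_iSup (fun w : {w // w < v ∧ grade ℕ w < grade ℕ v} =>
    LinearMap.ker (seqAction F _ (p w))) ⟨u.1, u.2, grade_strictMono u.2⟩

/-- A monic `q` of degree `d` amounts to a linear map `N` on `d`-tuples. Containing `U` prescribes
`N` on the initial tuples of sequences in `U`. By `eq_zero_of_mem_avoiding` these tuples determine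
the sequence and meet the normal tuples only in `0`, so `N` can still be prepending on a complement.
-/
theorem exists_isFreeExtension : ∃ q, IsFreeExtension b v (solutionsBelow p v) q := by
  classical
  set d := grade ℕ v with hd
  set U := solutionsBelow p v with hU
  have hshift : ∀ s ∈ U, ∀ i, (seqShift F _ ^ i) s ∈ U := by
    intro s hs i
    refine (iSup_le fun w => ?_ : U ≤ U.comap (seqShift F _ ^ i)) hs
    exact fun t ht => ker_le_solutionsBelow w.2 (seqShift_pow_mem_ker ht i)
  have havoid : ∀ s ∈ U, ∀ u, ¬ u < v → s d ∈ avoiding b u := by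
    intro s hs u hu
    refine (iSup_le fun w => ?_ : U ≤ (avoiding b u).comap (LinearMap.proj d)) hs
    exact fun t ht => (hp w w.2).apply_mem ht (grade_mono w.2.le) fun h => hu (h.trans_lt w.2)
  let I : U →ₗ[F] (Fin d → M) := (initial F _ d).domRestrict U
  have hI : Function.Injective I := by
    refine (injective_iff_map_eq_zero I).2 ?_
    rintro ⟨s, hs⟩ h
    refine Subtype.ext (eq_zero_of_mem_avoiding hp hs fun u hu => ?_)
    have : s (grade ℕ u) = 0 := congrFun h ⟨grade ℕ u, grade_strictMono hu⟩
    change s (grade ℕ u) ∈ _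
    rw [this]
    exact Submodule.zero_mem _
  have hdisj : Disjoint (normalTuples b v) (LinearMap.range I) := by
    rw [Submodule.disjoint_def]
    rintro _ hx ⟨⟨s, hs⟩, rfl⟩
    have : s = 0 := eq_zero_of_mem_avoiding hp hs fun u hu => mem_normalTuples.1 hx u hu
    subst this
    exact map_zero I
  -- The complement is taken to contain the normal tuples, which gives `lowerPart_normal`.
  obtain ⟨Z, hZ, hc⟩ := hdisj.exists_isCompl
  let h : (Fin d → M) →ₗ[F] U :=
    (LinearEquiv.ofInjective I hI).symm.toLinearMap ∘ₗ
      Submodule.projectionOnto (LinearMap.range I) Z hc.symm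
  have hhI : ∀ s, h (I s) = s := by
    intro s
    have : Submodule.projectionOnto (LinearMap.range I) Z hc.symm (I s) =
        LinearEquiv.ofInjective I hI s :=
      Submodule.projectionOnto_apply_left hc.symm (LinearEquiv.ofInjective I hI s)
    simp only [h, LinearMap.comp_apply, this]
    exact LinearEquiv.symm_apply_apply _ s
  have hhZ : ∀ z ∈ Z, h z = 0 := by
    intro z hz
    have : Submodule.projectionOnto (LinearMap.range I) Z hc.symm z = 0 :=
      Submodule.projectionOnto_apply_right hc.symm ⟨z, hz⟩
    simp only [h, LinearMap.comp_apply, this]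
    exact map_zero _
  -- On `Z` this prepends; on the initial tuple of `s` in `U` it gives `-s d`, as the recurrence for
  -- `s` demands.
  let N : (Fin d → M) →ₗ[F] M :=
    prepend b v ∘ₗ (LinearMap.id - I ∘ₗ h) - LinearMap.proj d ∘ₗ U.subtype ∘ₗ h
  have hN : ∀ x, N x = prepend b v (x - I (h x)) - (h x).1 d := fun x => rfl
  let q : (Module.End F M)[X] :=
    X ^ d + ∑ j : Fin d, C (N ∘ₗ LinearMap.single F _ j) * X ^ (j : ℕ)
  have hdeg : (∑ j : Fin d, C (N ∘ₗ LinearMap.single F (fun _ => M) j) *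
      X ^ (j : ℕ)).degree < (d : WithBot ℕ) :=
    (degree_sum_le _ _).trans_lt ((Finset.sup_lt_iff (WithBot.bot_lt_coe d)).2 fun j _ =>
      (degree_C_mul_X_pow_le _ _).trans_lt (WithBot.coe_lt_coe.2 j.2))
  have hcoeff : ∀ j : Fin d, q.coeff j = N ∘ₗ LinearMap.single F _ j := by
    intro j
    simp only [q, coeff_add, finsetSum_coeff, coeff_C_mul, coeff_X_pow]
    rw [if_neg j.2.ne, zero_add, Finset.sum_eq_single j]
    · simp
    · intro k _ hk
      rw [if_neg (fun e => hk (Fin.ext e.symm)), mul_zero]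
    · simp
  have hlow : ∀ x, lowerPart d q x = N x := by
    intro x
    rw [lowerPart_apply]
    simp only [hcoeff, LinearMap.comp_apply]
    rw [← map_sum]
    congr 1
    exact LinearMap.sum_single_apply (fun _ => M) x
  have hq1 : q.coeff d = 1 := by
    rw [show q.coeff d = (X ^ d + _ : (Module.End F M)[X]).coeff d from rfl,
      coeff_add, coeff_X_pow_self, coeff_eq_zero_of_degree_lt hdeg, add_zero]
  have hqd : q.natDegree ≤ d := by
    refine natDegree_add_le_of_degree_le (natDegree_X_pow_le d) ?_
    exact natDegree_le_of_degree_le hdeg.le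
  refine ⟨q, hq1, hqd, ?_, ?_, ?_, ?_⟩
  · intro s hs
    rw [seqAction_eq_zero_iff hq1 hqd]
    intro i
    rw [hlow, hN]
    have e := hhI ⟨_, hshift s hs i⟩
    change h (initial F _ d ((seqShift F _ ^ i) s)) = _ at e
    rw [e]
    change _ = -(prepend b v (initial F _ d ((seqShift F _ ^ i) s) -
      initial F _ d ((seqShift F _ ^ i) s)) - _)
    rw [sub_self, map_zero, zero_sub, neg_neg]
    change _ = (seqShift F _ ^ i) s d
    rw [seqShift_pow_apply, add_comm]
  · intro x u hu
    rw [hlow, hN]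
    exact Submodule.sub_mem _ (prepend_mem_avoiding b (fun e => hu e.le) _)
      (havoid _ (h x).2 u fun hlt => hu hlt.le)
  · intro x hx
    rw [hlow, hN] at hx
    -- The prepended part must avoid `v`, but its components at words starting at `v` are those of
    -- `x - I (h x)`, which therefore vanishes.
    have hx' := (Submodule.sub_mem_iff_left _ (havoid _ (h x).2 v (lt_irrefl v))).1 hx
    refine ⟨_, (h x).2, ?_⟩
    change I (h x) = x
    rw [eq_comm, ← sub_eq_zero]
    funext j
    refine b.ext_elem fun W => ?_
    rw [← repr_prepend_cons b v (x - I (h x)) j W, hx' j W, Pi.zero_apply, map_zero, Finsupp.zero_apply]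
  · intro x hx
    rw [hlow, hN, hhZ x (hZ hx), map_zero, sub_zero]
    exact sub_zero _

end Step

open Classical in
/-- A system of free extensions, one for each vertex. -/
def recurrencePoly (v : P) :
    (Module.End F M)[X] :=
  if h : ∃ q, IsFreeExtension b v
      (⨆ w : {w // w < v}, LinearMap.ker (seqAction F _ (recurrencePoly w.1))) q
    then h.choose else 0
termination_by grade ℕ v
decreasing_by all_goals exact grade_strictMono w.2

open Classical in
theorem recurrencePoly_def (v : P) : recurrencePoly b v =
    if h : ∃ q, IsFreeExtension b v (solutionsBelow (recurrencePoly b) v) q then h.choose else 0 := by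
  rw [recurrencePoly]
  rfl

/-- By induction on the grade the extension always exists, so the default value `0` is never taken.
-/
theorem recurrencePoly_isFreeExtension (v : P) :
    IsFreeExtension b v (solutionsBelow (recurrencePoly b) v) (recurrencePoly b v) := by
  generalize hr : grade ℕ v = r
  induction r using Nat.strong_induction_on generalizing v with
  | _ r ih =>
  have h := exists_isFreeExtension (p := recurrencePoly b) (v := v)
    fun w hw => ih _ (hr ▸ grade_strictMono hw) w rfl
  have e := recurrencePoly_def b v
  rw [dif_pos h] at e
  exact e ▸ h.choose_spec

theorem exists_recurrencePoly_eq (e : HasseEdge P) :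
    ∃ a : Module.End F M, recurrencePoly b e.tail =
      (X - C a : (Module.End F M)[X]) * recurrencePoly b e.head := by
  have ht := recurrencePoly_isFreeExtension b e.tail
  have hh := recurrencePoly_isFreeExtension b e.head
  have hc : grade ℕ e.head + 1 = grade ℕ e.tail := Nat.covBy_iff_add_one_eq.1 (e.2.grade ℕ)
  exact exists_eq_X_sub_C_mul (hc ▸ ht.coeff_grade) (hc ▸ ht.natDegree_le) hh.coeff_grade
    hh.natDegree_le ((ker_le_solutionsBelow e.2.lt).trans ht.le_ker)

theorem recurrencePoly_monic (v : P) : (recurrencePoly b v).Monic :=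
  monic_of_natDegree_le_of_coeff_eq_one _ (recurrencePoly_isFreeExtension b v).natDegree_le
    (recurrencePoly_isFreeExtension b v).coeff_grade

variable [OrderBot P]

theorem recurrencePoly_bot : recurrencePoly b (⊥ : P) = 1 := by
  have h := recurrencePoly_isFreeExtension b (⊥ : P)
  refine (recurrencePoly_monic b ⊥).natDegree_eq_zero.1 ?_
  have := h.natDegree_le
  rw [grade_bot] at this
  exact Nat.le_zero.1 this

/-- The action of the splitting algebra on the word space. -/
def action : SplittingAlgebra F P →ₐ[F] Module.End F M :=
  lift (recurrencePoly_monic b) fun e => (exists_recurrencePoly_eq b e).choose_spec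

variable [Finite P]

theorem action_letterValue (x : Letter P) :
    action b (letterValue F x) = (recurrencePoly b x.1).coeff x.2 :=
  lift_vertexPoly_coeff _ _ (recurrencePoly_bot b) _ _

/-- For a normal word `⟨v, j⟩ :: W`, the tuple with `b W` in place `j` and zeros elsewhere is a
normal tuple, and on those the recurrence prepends. -/
theorem action_wordValue {W : List (Letter P)} (h : IsNormal W) :
    action b (wordValue F W) (b []) = b W := by
  classical
  induction W with
  | nil => rw [wordValue_nil, map_one, Module.End.one_apply]
  | cons x W ih =>
    rw [IsNormal, List.isChain_cons] at h
    rw [wordValue_cons, map_mul, Module.End.mul_apply, ih h.2, action_letterValue]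
    obtain ⟨v, j⟩ := x
    have hmem : Pi.single j (b W) ∈ normalTuples b v := by
      rw [mem_normalTuples]
      intro u hu i V
      rw [Pi.single_apply]
      split_ifs with hj
      · rw [b.repr_self, Finsupp.single_apply, if_neg]
        rintro rfl
        exact h.1 ⟨u, i⟩ rfl ⟨hu, congrArg Fin.val hj⟩
      · rw [map_zero, Finsupp.zero_apply]
    rw [← prepend_single b, ← (recurrencePoly_isFreeExtension b v).lowerPart_normal _ hmem,
      lowerPart_apply, Finset.sum_eq_single j]
    · rw [Pi.single_eq_same]
    · intro k _ hk
      rw [Pi.single_eq_of_ne hk, map_zero]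
    · simp

theorem linearIndependent_wordValue :
    LinearIndependent F fun W : {W : List (Letter P) // IsNormal W} => wordValue F W.1 := by
  let b : Module.Basis (List (Letter P)) F (List (Letter P) →₀ F) := Finsupp.basisSingleOne
  let f : SplittingAlgebra F P →ₗ[F] (List (Letter P) →₀ F) :=
    LinearMap.applyₗ (b []) ∘ₗ (action b).toLinearMap
  refine LinearIndependent.of_comp f ?_
  have e : (f ∘ fun W : {W : List (Letter P) // IsNormal W} => wordValue F W.1) =
      b ∘ Subtype.val :=
    funext fun W => action_wordValue b W.2
  rw [e]
  exact b.linearIndependent.comp _ Subtype.val_injective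

theorem finrank_part (d : ℕ) : Module.finrank F (part F P d) = (normalWords P d).card := by
  have hs : {W : List (Letter P) | IsNormal W ∧ wordDegree W = d} = ↑(normalWords P d) := by
    ext W
    simp
  have hinj : LinearIndependent F fun W : normalWords P d => wordValue F W.1 :=
    linearIndependent_wordValue.comp
      (fun W : normalWords P d => ⟨W.1, (mem_normalWords.1 W.2).1⟩)
      fun V W h => Subtype.ext (Subtype.mk.inj h)
  have hr : wordValue F '' (normalWords P d : Set (List (Letter P))) =
      Set.range fun W : normalWords P d => wordValue F W.1 := by
    ext
    simp
  rw [part_eq_span_normal, hs, hr, finrank_span_eq_card hinj, Fintype.card_coe]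

theorem hilbertSeries_part : hilbertSeries F (part F P) = normalSeries P := by
  ext d
  simp only [hilbertSeries, normalSeries, PowerSeries.coeff_mk, finrank_part]

end Representation

end SplittingAlgebra

end

theorem theorem4p3 (F : Type*) [Field F] (n : ℕ) :
    hilbertSeries F (SplittingAlgebra.part F (Finset (Fin n))) =
      (1 - PowerSeries.X) * (1 - PowerSeries.X * (2 - PowerSeries.X) ^ n)⁻¹ := by
  rw [PowerSeries.eq_mul_inv_iff_mul_eq (by simp), SplittingAlgebra.hilbertSeries_part,
    SplittingAlgebra.normalSeries_finset_mul]
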